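/- Fix an infinite set of symbols from which the letters of all alphabets are taken, together with a special symbol $e$ of rank $0$ that represents the empty string. A *ranked alphabet* is a set of symbols each with a rank in $\mathbb{N}_0$; $T_\Sigma$ is the set of trees over $\Sigma$, written as strings in prefix notation, in which a node labelled by a symbol of rank $k$ has $k$ children. A *$k$-ary pattern* over $\Sigma$ is a tree over $\Sigma\cup\{x_1,\dots,x_k\}$ (the variables having rank $0$) in which each of $x_1,\dots,x_k$ occurs exactly once. The *yield* of $t\in T_\Sigma$ is the string obtained from $t$ by erasing every symbol that has positive rank or equals $e$. A *multiple context-free tree grammar* (MCFTG) is a system $G=(N,\mathcal N,\Sigma,S,R)$ where $N$ and $\Sigma$ are disjoint finite ranked alphabets (nonterminals and terminals), $\Sigma$ has a symbol of positive rank, $\mathcal N$ is a finite set of nonempty repetition-free sequences of nonterminals (big nonterminals), distinct elements of which have distinct underlying sets, $S\in\mathcal N$ is a single nonterminal of rank $0$, and $R$ is a finite set of rules $A\to(u,\mathcal L)$ with $A=(A_1,\dots,A_n)\in\mathcal N$, $u=(u_1,\dots,u_n)$ where $u_i$ is a pattern over $N\cup\Sigma$ of arity $\mathrm{rk}(A_i)$,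 no nonterminal occurs more than once in $u$, and $\mathcal L\subseteq\mathcal N$ is such that the underlying sets of the elements of $\mathcal L$ partition the set of nonterminals occurring in $u$. The forest languages $L(G,A)$, $A\in\mathcal N$, are simultaneously the smallest sets such that, for every rule $A\to(u,\mathcal L)$ and every choice of forests $f(B)\in L(G,B)$ for $B\in\mathcal L$, the forest obtained from $u$ by second-order substitution of the $i$-th pattern of $f(B)$ for the $i$-th nonterminal of $B$ (for all $B\in\mathcal L$ and all $i$ simultaneously) is in $L(G,A)$. The tree language of $G$ is $L(G)=L(G,S)\subseteq T_\Sigma$. The grammar $G$ is a *multiple regular tree grammar* (MRTG) if all nonterminals have rank $0$. A *multiple context-free grammar* (MCFG) is an MCFTG whose terminal alphabet is $\Sigma\cup\{e\}$ with $e\notin\Sigma$ and all symbols of $\Sigma$ of rank $1$, whose nonterminals other than $S$ all have rank $1$, in which no big nonterminal other than $S$ itself contains $S$, and in which $S$ does not occur in right-hand sides of rules; its string language is $\{w\in\Sigma^* \mid we\in L(G)\}$. Let $\mathrm{MCFT}$ and $\mathrm{MRT}$ be the classes of tree languages generated by MCFTGs and MRTGs, let $\mathrm{MCF}$ be the class of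 string languages generated by MCFGs, and for a class $X$ of tree languages let $\mathrm{y}X$ be the class of all string languages $\{\mathrm{yield}(t)\mid t\in L\}$ with $L\in X$. Then $$\mathrm{yMCFT}=\mathrm{MCF}=\mathrm{yMRT}.$$ -/

import Mathlib

namespace MultipleCF

universe u v

/-! ### Trees, patterns, substitution -/

/-- Trees over the ranked set `(S, rk)` with variables `x₀, x₁, x₂, …` (of rank `0`). -/
inductive RTree {S : Type u} (rk : S → ℕ) : Type u
  | var (i : ℕ) : RTree rk
  | node (s : S) (t : Fin (rk s) → RTree rk) : RTree rk

namespace RTree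

variable {S : Type u} {S' : Type v} {rk : S → ℕ} {rk' : S' → ℕ}

/-- The symbols of `S` labelling the nodes of a tree, in preorder. For a tree without variables
this is the tree itself, when trees are written as strings in prefix notation. -/
def labels : RTree rk → List S
  | var _ => []
  | node s t => s :: (List.ofFn fun i => (t i).labels).flatten

/-- The occurrences of variables in a tree, from left to right. -/
def vars : RTree rk → List ℕ
  | var i => [i]
  | node _ t => (List.ofFn fun i => (t i).vars).flatten

/-- `t` is a `k`-ary pattern: each of the first `k` variables occurs exactly once in `t`,
and no other variable occurs. -/
def IsPattern (k : ℕ) (t : RTree rk) : Prop :=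
  t.vars.Perm (List.range k)

/-- First-order substitution: every variable `xᵢ` is replaced by `f i`. -/
def bind (f : ℕ → RTree rk) : RTree rk → RTree rk
  | var i => f i
  | node s t => node s fun i => (t i).bind f

/-- The pattern `σ(x₀, …, x_{k-1})` for a symbol `σ` of rank `k`. -/
def init (s : S) : RTree rk :=
  node s fun i => var i

/-- The tree homomorphism determined by `h` (second-order substitution): each node with label `s`
is replaced by `h s`, into which the images of its subtrees are substituted for the first
`rk s` variables. -/
def hom (h : S → RTree rk') : RTree rk → RTree rk'
  | var i => var i
  | node s t => (h s).bind fun i => if hi : i < rk s then (t ⟨i, hi⟩).hom h else var i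

end RTree

/-! ### Ranked alphabets and yields -/

/-- A finite ranked alphabet with symbols `some a`, for letters `a : A`, and possibly the special
symbol `e = none` that stands for the empty string and always has rank `0`. -/
structure RankedAlphabet (A : Type u) where
  symbols : Finset (Option A)
  rank : symbols → ℕ
  rank_e : ∀ h : none ∈ symbols, rank ⟨none, h⟩ = 0

/-- The trees over a ranked alphabet (with variables). -/
abbrev RankedAlphabet.Trees {A : Type u} (T : RankedAlphabet A) : Type u :=
  RTree T.rank

/-- The yield of a tree: the string of the symbols of rank `0` in it, with `e` omitted. -/
def treeYield {A : Type u} (T : RankedAlphabet A) (t : T.Trees) : List A :=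
  t.labels.filterMap fun s => if T.rank s = 0 then s.1 else none

/-! ### Multiple context-free tree grammars -/

section Grammar

variable {A : Type u}

/-- The rank function on the disjoint union of nonterminals and terminals. -/
abbrev sumRank (T : RankedAlphabet A) {N : Type} (rkN : N → ℕ) : N ⊕ T.symbols → ℕ :=
  Sum.elim rkN T.rank

/-- A rule `lhs → (rhs, links)`. -/
structure Rule (T : RankedAlphabet A) {N : Type} (rkN : N → ℕ) where
  lhs : List N
  rhs : List (RTree (sumRank T rkN))
  links : Set (List N)

/-- The occurrences of nonterminals in a forest, from left to right. -/
def nonterminals {T : RankedAlphabet A} {N : Type} {rkN : N → ℕ}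
    (w : List (RTree (sumRank T rkN))) : List N :=
  w.flatMap fun t => t.labels.filterMap Sum.getLeft?

/-- Multiple context-free tree grammars with terminal alphabet `T`. -/
structure MCFTG (T : RankedAlphabet A) where
  /-- the nonterminals -/
  N : Type
  finite_N : Finite N
  rkN : N → ℕ
  /-- the big nonterminals -/
  big : Set (List N)
  finite_big : big.Finite
  big_ne_nil : ∀ B ∈ big, B ≠ []
  big_nodup : ∀ B ∈ big, B.Nodup
  big_inj : ∀ B ∈ big, ∀ B' ∈ big, (∀ C, C ∈ B ↔ C ∈ B') → B = B'
  /-- not all terminals have rank `0` -/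
  exists_rank_pos : ∃ s, 1 ≤ T.rank s
  /-- the initial nonterminal -/
  S : N
  S_big : [S] ∈ big
  S_rank : rkN S = 0
  rules : Set (Rule T rkN)
  finite_rules : rules.Finite
  lhs_big : ∀ r ∈ rules, r.lhs ∈ big
  /-- the right-hand side is a forest of patterns with the same multiple rank as the
  left-hand side -/
  rhs_pattern : ∀ r ∈ rules, List.Forall₂ (fun C t => t.IsPattern (rkN C)) r.lhs r.rhs
  /-- no nonterminal occurs more than once in the right-hand side -/
  rhs_unique : ∀ r ∈ rules, (nonterminals r.rhs).Nodup
  links_big : ∀ r ∈ rules, r.links ⊆ big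
  /-- the links partition the set of nonterminals that occur in the right-hand side -/
  links_cover : ∀ r ∈ rules, ∀ C, C ∈ nonterminals r.rhs ↔ ∃ B ∈ r.links, C ∈ B
  links_disjoint : ∀ r ∈ rules, ∀ B ∈ r.links, ∀ B' ∈ r.links, B ≠ B' → B.Disjoint B'

namespace MCFTG

variable {T : RankedAlphabet A}

/-- Second-order substitution of `g C` for every nonterminal `C`; terminals are left unchanged. -/
def replace {N : Type} {rkN : N → ℕ} (g : N → T.Trees) :
    RTree (sumRank T rkN) → T.Trees :=
  RTree.hom (Sum.elim g RTree.init)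

/-- `G.Generates B w` says that the forest `w` belongs to the forest language `L(G, B)`; these
languages are defined simultaneously as the smallest ones closed under the rules.
The forest substituted for a link `B = (C₁, …, Cₘ)` is `(g C₁, …, g Cₘ)`; since the links of a rule
are repetition-free, pairwise disjoint, and cover the nonterminals of the right-hand side, any choice
of one forest (of length `m`) for each link is of this form, and the values of `g` elsewhere are
irrelevant. By induction, `G.Generates B w` implies that `w` has the same multiple rank as `B`. -/
inductive Generates (G : MCFTG T) : List G.N → List T.Trees → Prop
  | rule (r : Rule T G.rkN) (hr : r ∈ G.rules) (g : G.N → T.Trees)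
      (hg : ∀ B ∈ r.links, Generates G B (B.map g)) :
      Generates G r.lhs (r.rhs.map (replace g))

/-- The tree language `L(G) = L(G, S)`. -/
def treeLanguage (G : MCFTG T) : Set T.Trees :=
  {t | G.Generates [G.S] [t]}

/-- Multiple regular tree grammars: all nonterminals have rank `0`. -/
def IsMRTG (G : MCFTG T) : Prop :=
  ∀ C : G.N, G.rkN C = 0

/-- Multiple context-free (string) grammars: the terminal alphabet is monadic with the end marker
`e`, all nonterminals other than `S` have rank `1`, no big nonterminal other than `S` itself contains
`S`, and `S` does not occur in right-hand sides of rules. -/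
structure IsMCFG (G : MCFTG T) : Prop where
  e_mem : none ∈ T.symbols
  rank_letter : ∀ (a : A) (h : some a ∈ T.symbols), T.rank ⟨some a, h⟩ = 1
  rank_nonterminal : ∀ C : G.N, C ≠ G.S → G.rkN C = 1
  S_big_only : ∀ B ∈ G.big, G.S ∈ B → B = [G.S]
  start_separated : ∀ r ∈ G.rules, G.S ∉ nonterminals r.rhs

/-- The strings `w` for which the monadic tree `w e` belongs to `L(G)`. -/
def stringLanguage (G : MCFTG T) : Language A :=
  {w | ∃ t ∈ G.treeLanguage, t.labels.map Subtype.val = w.map some ++ [none]}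

end MCFTG

end Grammar

/-! ### Language classes -/

/-- Classes of tree languages with symbols from `A` (and `e`). -/
abbrev TreeLanguageClass (A : Type u) : Type u :=
  (T : RankedAlphabet A) → Set (Set T.Trees)

/-- The class of multiple context-free tree languages. -/
def MCFT (A : Type u) : TreeLanguageClass A :=
  fun T => {L | ∃ G : MCFTG T, G.treeLanguage = L}

/-- The class of multiple regular tree languages. -/
def MRT (A : Type u) : TreeLanguageClass A :=
  fun T => {L | ∃ G : MCFTG T, G.IsMRTG ∧ G.treeLanguage = L}

/-- The class of multiple context-free string languages. -/
def MCF (A : Type u) : Set (Language A) :=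
  {L | ∃ (T : RankedAlphabet A) (G : MCFTG T), G.IsMCFG ∧ G.stringLanguage = L}

/-- The class `yX` of yield languages of the tree languages in `X`. -/
def yieldClass {A : Type u} (X : TreeLanguageClass A) : Set (Language A) :=
  {L | ∃ (T : RankedAlphabet A), ∃ K ∈ X T, treeYield T '' K = L}

end MultipleCF

/-! The proof closes the cycle yMCFT ⊆ MCF ⊆ yMRT ⊆ yMCFT, whose last inclusion is trivial.

All comparisons use derivations with values in a semantic domain (`Derives`). By `derives_map_iff`,
a map that commutes with the evaluation of right-hand sides carries the derivable values of one
domain exactly onto those of the other. Two domains suffice: strings with variables, where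
second-order substitution of trees becomes substitution of strings (`flat_hom`), and plain strings
of labels, available when substitution amounts to concatenation (`labels_replace`), as in MCFGs and
MRTGs.

MCF ⊆ yMRT: in an MCFG only the sequence of labels of a right-hand side matters. It is hung as
leaves on a comb built from a fresh binary symbol, and all nonterminals get rank 0
(`combGrammar_derives_iff`).

yMCFT ⊆ MCF: the yield of a `k`-ary pattern is a string in which each of `k` variables occurs once,
that is, an order of the variables together with `k + 1` segments. There are finitely many orders,
so the order is stored in the nonterminal, and a nonterminal of rank `k` is split into `k + 1`
string nonterminals, kept together in one big nonterminal. The orders on the right-hand side of a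
rule are guessed, and they determine the orders on the left (`svars_segmentString`). Correctness is
`Derives.segments` and its converse `MonadicDerives.exists_derives`; `monadicDerives_none_iff` adds
a new initial nonterminal. -/

namespace MultipleCF

universe u v w x

/-! ### Strings with variables -/

theorem flatMap_flatten {α : Type u} {β : Type v} (L : List (List α)) (f : α → List β) :
    L.flatten.flatMap f = (L.map (·.flatMap f)).flatten := by
  induction L <;> simp_all

section VString

variable {X : Type u} {Y : Type v}

/-- Strings over `X` with variables `x₀, x₁, x₂, …`. -/
abbrev VString (X : Type u) : Type u := List (X ⊕ ℕ)

/-- The occurrences of variables, from left to right. -/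
def svars (d : VString X) : List ℕ := d.filterMap Sum.getRight?

/-- The occurrences of symbols, from left to right. -/
def ssyms (d : VString X) : List X := d.filterMap Sum.getLeft?

/-- Substitution of `F i` for the variables `xᵢ`. -/
def sbind (F : ℕ → VString X) (d : VString X) : VString X :=
  d.flatMap (Sum.elim (fun a => [.inl a]) F)

/-- Substitution of the string `σ a` for the symbols `a`. -/
def smap (σ : X → List Y) (d : VString X) : VString Y :=
  d.flatMap (Sum.elim (fun a => (σ a).map .inl) fun i => [.inr i])

@[simp] theorem svars_nil : svars ([] : VString X) = [] := rfl
@[simp] theorem svars_inl (a : X) (d : VString X) : svars (.inl a :: d) = svars d := rfl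
@[simp] theorem svars_inr (i : ℕ) (d : VString X) : svars (.inr i :: d) = i :: svars d := rfl
@[simp] theorem svars_append (d d' : VString X) : svars (d ++ d') = svars d ++ svars d' :=
  List.filterMap_append ..
@[simp] theorem svars_map_inl (l : List X) : svars (l.map .inl) = [] := by
  induction l <;> simp_all
@[simp] theorem svars_map_inr (l : List ℕ) : svars (l.map .inr : VString X) = l := by
  induction l <;> simp_all

@[simp] theorem ssyms_nil : ssyms ([] : VString X) = [] := rfl
@[simp] theorem ssyms_inl (a : X) (d : VString X) : ssyms (.inl a :: d) = a :: ssyms d := rfl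
@[simp] theorem ssyms_inr (i : ℕ) (d : VString X) : ssyms (.inr i :: d) = ssyms d := rfl
@[simp] theorem ssyms_append (d d' : VString X) : ssyms (d ++ d') = ssyms d ++ ssyms d' :=
  List.filterMap_append ..
@[simp] theorem ssyms_map_inl (l : List X) : ssyms (l.map .inl) = l := by
  induction l <;> simp_all
@[simp] theorem ssyms_map_inr (l : List ℕ) : ssyms (l.map .inr : VString X) = [] := by
  induction l <;> simp_all

@[simp] theorem sbind_nil (F : ℕ → VString X) : sbind F [] = [] := rfl
@[simp] theorem sbind_inl (F : ℕ → VString X) (a : X) (d : VString X) :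
    sbind F (.inl a :: d) = .inl a :: sbind F d := rfl
@[simp] theorem sbind_inr (F : ℕ → VString X) (i : ℕ) (d : VString X) :
    sbind F (.inr i :: d) = F i ++ sbind F d := rfl
@[simp] theorem sbind_append (F : ℕ → VString X) (d d' : VString X) :
    sbind F (d ++ d') = sbind F d ++ sbind F d' := List.flatMap_append ..
@[simp] theorem sbind_map_inl (F : ℕ → VString X) (l : List X) :
    sbind F (l.map .inl) = l.map .inl := by
  induction l <;> simp_all
@[simp] theorem sbind_map_inr (F : ℕ → VString X) (l : List ℕ) :
    sbind F (l.map .inr) = l.flatMap F := by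
  induction l <;> simp_all

@[simp] theorem smap_nil (σ : X → List Y) : smap σ [] = [] := rfl
@[simp] theorem smap_inl (σ : X → List Y) (a : X) (d : VString X) :
    smap σ (.inl a :: d) = (σ a).map .inl ++ smap σ d := rfl
@[simp] theorem smap_inr (σ : X → List Y) (i : ℕ) (d : VString X) :
    smap σ (.inr i :: d) = .inr i :: smap σ d := rfl
@[simp] theorem smap_append (σ : X → List Y) (d d' : VString X) :
    smap σ (d ++ d') = smap σ d ++ smap σ d' := List.flatMap_append ..
@[simp] theorem smap_map_inl (σ : X → List Y) (l : List X) :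
    smap σ (l.map .inl) = (l.flatMap σ).map .inl := by
  induction l <;> simp_all
@[simp] theorem smap_map_inr (σ : X → List Y) (l : List ℕ) :
    smap σ (l.map .inr) = l.map .inr := by
  induction l <;> simp_all

theorem sbind_congr {F F' : ℕ → VString X} {d : VString X} (h : ∀ i ∈ svars d, F i = F' i) :
    sbind F d = sbind F' d := by
  induction d with
  | nil => rfl
  | cons c d ih => cases c <;> simp_all

theorem sbind_var (d : VString X) : sbind (fun i => [.inr i]) d = d := by
  induction d with
  | nil => rfl
  | cons c d ih => cases c <;> simp_all

theorem sbind_sbind (F F' : ℕ → VString X) (d : VString X) :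
    sbind F' (sbind F d) = sbind (fun i => sbind F' (F i)) d := by
  induction d with
  | nil => rfl
  | cons c d ih => cases c <;> simp_all

theorem svars_sbind (F : ℕ → VString X) (d : VString X) :
    svars (sbind F d) = (svars d).flatMap fun i => svars (F i) := by
  induction d with
  | nil => rfl
  | cons c d ih => cases c <;> simp_all

theorem ssyms_sbind_perm (F : ℕ → VString X) (d : VString X) :
    (ssyms (sbind F d)).Perm (ssyms d ++ (svars d).flatMap fun i => ssyms (F i)) := by
  induction d with
  | nil => rfl
  | cons c d ih =>
    cases c with
    | inl a => simpa using ih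
    | inr i =>
      simp only [sbind_inr, ssyms_append, ssyms_inr, svars_inr, List.flatMap_cons]
      exact (ih.append_left _).trans (by
        rw [← List.append_assoc, ← List.append_assoc]
        exact List.perm_append_comm.append_right _)

theorem svars_smap (σ : X → List Y) (d : VString X) : svars (smap σ d) = svars d := by
  induction d with
  | nil => rfl
  | cons c d ih => cases c <;> simp_all

theorem smap_sbind (σ : X → List Y) (F : ℕ → VString X) (d : VString X) :
    smap σ (sbind F d) = sbind (fun i => smap σ (F i)) (smap σ d) := by
  induction d with
  | nil => rfl
  | cons c d ih => cases c <;> simp_all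

/-! ### Splitting strings at their variables -/

/-- The segments between consecutive occurrences of variables. -/
def segs : VString X → List (List X)
  | [] => [[]]
  | .inl a :: d => (segs d).modifyHead (a :: ·)
  | .inr _ :: d => [] :: segs d

/-- The string with variables `p` and segments `w`. -/
def interleave : List ℕ → List (List X) → VString X
  -- Surplus segments are joined at the end and missing ones count as empty, so no length condition
  -- is needed in `smap_interleave`.
  | [], w => w.flatten.map .inl
  | i :: p, w => (w.headD []).map .inl ++ .inr i :: interleave p w.tail

theorem length_segs (d : VString X) : (segs d).length = (svars d).length + 1 := by
  induction d with
  | nil => rfl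
  | cons c d ih => cases c <;> simp_all [segs]

theorem segs_ne_nil (d : VString X) : segs d ≠ [] := by
  intro h
  simpa [h] using length_segs d

theorem interleave_segs (d : VString X) : interleave (svars d) (segs d) = d := by
  induction d with
  | nil => rfl
  | cons c d ih =>
    cases c with
    | inr i => simp [segs, interleave, ih]
    | inl a =>
      obtain ⟨s, l, hl⟩ := List.exists_cons_of_ne_nil (segs_ne_nil d)
      rw [hl] at ih
      conv_rhs => rw [← ih]
      simp only [segs, hl, svars_inl, List.modifyHead_cons]
      cases svars d <;> simp [interleave]

theorem svars_interleave (p : List ℕ) (w : List (List X)) : svars (interleave p w) = p := by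
  induction p generalizing w <;> simp_all [interleave, -List.map_flatten]

theorem ssyms_interleave (p : List ℕ) (w : List (List X)) (h : p.length < w.length) :
    ssyms (interleave p w) = w.flatten := by
  induction p generalizing w with
  | nil => simp [interleave, -List.map_flatten]
  | cons i p ih =>
    cases w with
    | nil => simp at h
    | cons s w => simp_all [interleave]

theorem segs_map_inl_append (l : List X) (d : VString X) :
    segs (l.map .inl ++ d) = (segs d).modifyHead (l ++ ·) := by
  induction l with
  | nil => cases h : segs d <;> simp [h]
  | cons a l ih => cases h : segs d <;> simp_all [segs]

theorem segs_smap (σ : X → List Y) (d : VString X) :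
    segs (smap σ d) = (segs d).map (·.flatMap σ) := by
  induction d with
  | nil => rfl
  | cons c d ih =>
    cases c with
    | inr i => simp [segs, ih]
    | inl a =>
      obtain ⟨s, l, hl⟩ := List.exists_cons_of_ne_nil (segs_ne_nil d)
      simp [segs, segs_map_inl_append, ih, hl]

theorem smap_interleave (σ : X → List Y) (p : List ℕ) (w : List (List X)) :
    smap σ (interleave p w) = interleave p (w.map (·.flatMap σ)) := by
  induction p generalizing w with
  | nil => rw [interleave, interleave, smap_map_inl, flatMap_flatten]
  | cons i p ih => cases w <;> simp [interleave, ih]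

theorem flatten_segs (d : VString X) : (segs d).flatten = ssyms d := by
  rw [← ssyms_interleave (svars d), interleave_segs]
  simp [length_segs]

end VString

/-! ### Flattening trees to strings with variables -/

theorem flatMap_range_dite {α : Type u} {k : ℕ} (f : Fin k → List α) (g : ℕ → List α) :
    ((List.range k).flatMap fun i => if hi : i < k then f ⟨i, hi⟩ else g i) =
      (List.ofFn f).flatten := by
  rw [List.flatMap, List.ofFn_eq_map, ← List.map_coe_finRange_eq_range, List.map_map]
  congr 1
  simp

theorem perm_flatten_ofFn {α : Type u} {k : ℕ} {f g : Fin k → List α} (h : ∀ i, (f i).Perm (g i)) :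
    (List.ofFn f).flatten.Perm (List.ofFn g).flatten := by
  rw [List.ofFn_eq_map, List.ofFn_eq_map]
  exact List.Perm.flatMap_left _ fun i _ => h i

namespace RTree

variable {S : Type u} {S' : Type v} {rk : S → ℕ} {rk' : S' → ℕ} {X : Type w} {Y : Type x}

theorem mem_labels_node {s s' : S} {t : Fin (rk s) → RTree rk} :
    s' ∈ (node s t).labels ↔ s' = s ∨ ∃ i, s' ∈ (t i).labels := by
  simp [labels]

/-- The string obtained from a tree when symbols `s` are interpreted by `h s`. -/
def flat (h : S → VString X) : RTree rk → VString X
  | var i => [.inr i]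
  | node s t => sbind (fun i => if hi : i < rk s then (t ⟨i, hi⟩).flat h else [.inr i]) (h s)

theorem flat_congr {h h' : S → VString X} {t : RTree rk} (hh : ∀ s ∈ t.labels, h s = h' s) :
    t.flat h = t.flat h' := by
  induction t with
  | var i => rfl
  | node s t ih =>
    rw [flat, flat, hh s (mem_labels_node.2 (.inl rfl))]
    refine sbind_congr fun i _ => ?_
    split_ifs with hi
    · exact ih _ fun s' hs' => hh s' (mem_labels_node.2 (.inr ⟨_, hs'⟩))
    · rfl

/-- Each interpretation uses every variable of its symbol exactly once, so flattening neither copies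
nor drops a subtree; it only reorders. -/
theorem svars_flat_perm {h : S → VString X} {t : RTree rk}
    (hh : ∀ s ∈ t.labels, (svars (h s)).Perm (List.range (rk s))) :
    (svars (t.flat h)).Perm t.vars := by
  induction t with
  | var i => rfl
  | node s t ih =>
    rw [flat, svars_sbind, vars]
    refine ((hh s (mem_labels_node.2 (.inl rfl))).flatMap_right _).trans ?_
    simp only [apply_dite svars]
    rw [flatMap_range_dite fun i => svars ((t i).flat h)]
    exact perm_flatten_ofFn fun i =>
      ih i fun s' hs' => hh s' (mem_labels_node.2 (.inr ⟨_, hs'⟩))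

theorem ssyms_flat_perm {h : S → VString X} {t : RTree rk}
    (hh : ∀ s ∈ t.labels, (svars (h s)).Perm (List.range (rk s))) :
    (ssyms (t.flat h)).Perm (t.labels.flatMap fun s => ssyms (h s)) := by
  induction t with
  | var i => rfl
  | node s t ih =>
    rw [flat, labels, List.flatMap_cons]
    refine (ssyms_sbind_perm _ _).trans (List.Perm.append_left _ ?_)
    refine ((hh s (mem_labels_node.2 (.inl rfl))).flatMap_right _).trans ?_
    simp only [apply_dite ssyms]
    rw [flatMap_range_dite fun i => ssyms ((t i).flat h), flatMap_flatten, List.map_ofFn]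
    exact perm_flatten_ofFn fun i =>
      ih i fun s' hs' => hh s' (mem_labels_node.2 (.inr ⟨_, hs'⟩))

/-- Flattening does not change the order of symbols if every symbol is interpreted by a string
followed by its variables in increasing order. -/
theorem ssyms_flat (l : S → List X) (t : RTree rk) :
    ssyms (t.flat fun s => (l s).map .inl ++ (List.range (rk s)).map .inr) =
      t.labels.flatMap l := by
  induction t with
  | var i => rfl
  | node s t ih =>
    simp only [flat, sbind_append, sbind_map_inl, sbind_map_inr, ssyms_append, ssyms_map_inl]
    rw [flatMap_range_dite fun i => (t i).flat _, labels, List.flatMap_cons, flatMap_flatten,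
      List.map_ofFn, ssyms, List.filterMap_flatten, List.map_ofFn]
    congr 3
    funext i
    exact ih i

theorem smap_flat (σ : X → List Y) (h : S → VString X) (t : RTree rk) :
    smap σ (t.flat h) = t.flat fun s => smap σ (h s) := by
  induction t with
  | var i => rfl
  | node s t ih =>
    rw [flat, flat, smap_sbind]
    congr 1
    funext i
    split_ifs <;> simp [ih]

/-- A variable beyond `rk s` in `h s` would stay fixed on the left but be replaced on the right,
hence the bound. -/
theorem flat_bind {h : S → VString X} (hh : ∀ s, ∀ i ∈ svars (h s), i < rk s) (f : ℕ → RTree rk)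
    (t : RTree rk) : (t.bind f).flat h = sbind (fun i => (f i).flat h) (t.flat h) := by
  induction t with
  | var i => simp [bind, flat]
  | node s t ih =>
    rw [bind, flat, flat, sbind_sbind]
    refine sbind_congr fun i hi => ?_
    simp [hh s i hi, ih]

theorem flat_init {h : S → VString X} (s : S) : (init s : RTree rk).flat h = h s := by
  simp [init, flat, sbind_var]

theorem flat_hom {h : S' → VString X} (hh : ∀ s, ∀ i ∈ svars (h s), i < rk' s)
    (g : S → RTree rk') (t : RTree rk) :
    (t.hom g).flat h = t.flat fun s => (g s).flat h := by
  induction t with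
  | var i => rfl
  | node s t ih =>
    rw [hom, flat, flat_bind hh]
    congr 1
    funext i
    split_ifs <;> simp [ih, flat]

end RTree

theorem flatten_ofFn_of_eq_zero {α : Type u} {k : ℕ} (h : k = 0) (f : Fin k → List α) :
    (List.ofFn f).flatten = [] := by
  subst h
  simp

theorem flatten_ofFn_of_eq_one {α : Type u} {k : ℕ} (h : k = 1) (f : Fin k → List α) :
    (List.ofFn f).flatten = f ⟨0, by omega⟩ := by
  subst h
  simp

theorem flatten_ofFn_of_eq_two {α : Type u} {k : ℕ} (h : k = 2) (f : Fin k → List α) :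
    (List.ofFn f).flatten = f ⟨0, by omega⟩ ++ f ⟨1, by omega⟩ := by
  subst h
  simp [List.ofFn_succ]

namespace RTree

variable {S : Type u} {rk : S → ℕ} {s : S} {t : Fin (rk s) → RTree rk}

theorem vars_node_of_rank_eq_zero (h : rk s = 0) : (node s t).vars = [] :=
  flatten_ofFn_of_eq_zero h _

theorem labels_node_of_rank_eq_zero (h : rk s = 0) : (node s t).labels = [s] :=
  congrArg (s :: ·) (flatten_ofFn_of_eq_zero h _)

theorem vars_node_of_rank_eq_one (h : rk s = 1) : (node s t).vars = (t ⟨0, by omega⟩).vars :=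
  flatten_ofFn_of_eq_one h _

theorem labels_node_of_rank_eq_one (h : rk s = 1) :
    (node s t).labels = s :: (t ⟨0, by omega⟩).labels :=
  congrArg (s :: ·) (flatten_ofFn_of_eq_one h _)

theorem vars_node_of_rank_eq_two (h : rk s = 2) :
    (node s t).vars = (t ⟨0, by omega⟩).vars ++ (t ⟨1, by omega⟩).vars :=
  flatten_ofFn_of_eq_two h _

theorem labels_node_of_rank_eq_two (h : rk s = 2) :
    (node s t).labels = s :: ((t ⟨0, by omega⟩).labels ++ (t ⟨1, by omega⟩).labels) :=
  congrArg (s :: ·) (flatten_ofFn_of_eq_two h _)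

end RTree

/-! ### Derivations with values in a semantic domain -/

section Derives

variable {A : Type u} {T : RankedAlphabet A}

theorem mem_nonterminals {N : Type} {rkN : N → ℕ} {l : List (RTree (sumRank T rkN))} {C : N} :
    C ∈ nonterminals l ↔ ∃ t ∈ l, Sum.inl C ∈ t.labels := by
  simp [nonterminals]

theorem exists_map_eq {N : Type v} {D : Type w} [Nonempty D] {B : List N} (hB : B.Nodup)
    {d : List D} (h : d.length = B.length) : ∃ g : N → D, B.map g = d := by
  classical
  induction B generalizing d with
  | nil => exact ⟨fun _ => Classical.arbitrary D, by simpa [eq_comm] using h⟩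
  | cons C B ih =>
    obtain _ | ⟨c, d⟩ := d
    · simp at h
    obtain ⟨hC, hB⟩ := List.nodup_cons.1 hB
    obtain ⟨g, rfl⟩ := ih hB (by simpa using h)
    refine ⟨Function.update g C c, ?_⟩
    rw [List.map_cons, Function.update_self]
    congr 1
    refine List.map_congr_left fun C' hC' => Function.update_of_ne ?_ _ _
    rintro rfl
    exact hC hC'

theorem exists_map_eq_of_disjoint {N : Type v} {D : Type w} [Nonempty D] {K : Set (List N)}
    (hK : ∀ B ∈ K, B.Nodup) (hd : ∀ B ∈ K, ∀ B' ∈ K, B ≠ B' → B.Disjoint B')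
    {f : List N → List D} (hf : ∀ B ∈ K, (f B).length = B.length) :
    ∃ g : N → D, ∀ B ∈ K, B.map g = f B := by
  classical
  choose! g hg using fun B (hB : B ∈ K) => exists_map_eq (hK B hB) (hf B hB)
  choose! b hb hCb using fun (C : N) (h : ∃ B, B ∈ K ∧ C ∈ B) => h
  -- `b C` is a link that contains `C`; by disjointness it is the only one, so the choices for the
  -- links glue to one function.
  refine ⟨fun C => g (b C) C, fun B hB => ?_⟩
  rw [← hg B hB]
  refine List.map_congr_left fun C hC => ?_
  have hbB : b C = B := by
    by_contra hne
    exact hd _ (hb C ⟨B, hB, hC⟩) _ hB hne (hCb C ⟨B, hB, hC⟩) hC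
  rw [hbB]

open MCFTG (replace)

namespace MCFTG

variable (G : MCFTG T) {D : Type v} {D' : Type w}

/-- The derivable lists of values in `D`, where `ev g t` is the value of the tree `t` if the
nonterminals `C` have the values `g C`. -/
inductive Derives (ev : (G.N → D) → RTree (sumRank T G.rkN) → D) : List G.N → List D → Prop
  | rule (r : Rule T G.rkN) (hr : r ∈ G.rules) (g : G.N → D)
      (hg : ∀ B ∈ r.links, Derives ev B (B.map g)) :
      Derives ev r.lhs (r.rhs.map (ev g))

variable {G}

theorem generates_iff_derives {B : List G.N} {l : List T.Trees} :
    G.Generates B l ↔ G.Derives replace B l := by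
  constructor
  · intro h
    induction h with
    | rule r hr g _ ih => exact .rule r hr g ih
  · intro h
    induction h with
    | rule r hr g _ ih => exact .rule r hr g ih

/-- If `C` occurs in the right-hand side of a rule, its value occurs in one of the links. -/
theorem forall_nonterminals {r : Rule T G.rkN} (hr : r ∈ G.rules) {g : G.N → D}
    {P : G.N → D → Prop} (h : ∀ B ∈ r.links, List.Forall₂ P B (B.map g)) :
    ∀ t ∈ r.rhs, ∀ C, Sum.inl C ∈ t.labels → P C (g C) := by
  intro t ht C hC
  obtain ⟨B, hB, hCB⟩ := (G.links_cover r hr C).1 (mem_nonterminals.2 ⟨t, ht, hC⟩)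
  have := h B hB
  rw [List.forall₂_map_right_iff, List.forall₂_same] at this
  exact this C hCB

variable {ev : (G.N → D) → RTree (sumRank T G.rkN) → D}
  {ev' : (G.N → D') → RTree (sumRank T G.rkN) → D'} {B : List G.N}

/-- A property of values, depending on the rank, that is preserved by evaluation. -/
def Preserves (ev : (G.N → D) → RTree (sumRank T G.rkN) → D) (Q : ℕ → D → Prop) : Prop :=
  ∀ (g : G.N → D) (k : ℕ) (t : RTree (sumRank T G.rkN)), t.IsPattern k →
    (∀ C, Sum.inl C ∈ t.labels → Q (G.rkN C) (g C)) → Q k (ev g t)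

theorem Derives.forall₂ {Q : ℕ → D → Prop} (hQ : Preserves ev Q) {d : List D}
    (h : G.Derives ev B d) : List.Forall₂ (fun C => Q (G.rkN C)) B d := by
  induction h with
  | rule r hr g _ ih =>
    have h1 := forall_nonterminals hr ih
    rw [List.forall₂_map_right_iff]
    refine List.forall₂_iff_zip.2 ⟨(G.rhs_pattern r hr).length_eq, fun {C t} hCt => ?_⟩
    exact hQ g _ t ((List.forall₂_iff_zip.1 (G.rhs_pattern r hr)).2 hCt)
      (h1 t (List.of_mem_zip hCt).2)

theorem Derives.length_eq {d : List D} (h : G.Derives ev B d) : d.length = B.length :=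
  (h.forall₂ (Q := fun _ _ => True) fun _ _ _ _ _ => trivial).length_eq.symm

/-- Derivations are preserved and reflected by homomorphisms of semantic domains. -/
theorem derives_map_iff [Nonempty D] {Q : ℕ → D → Prop} (hQ : Preserves ev Q) {φ : D → D'}
    (hφ : ∀ (g : G.N → D) (g' : G.N → D') (t : RTree (sumRank T G.rkN)),
      (∀ C, Sum.inl C ∈ t.labels → Q (G.rkN C) (g C) ∧ g' C = φ (g C)) →
        ev' g' t = φ (ev g t)) {d' : List D'} :
    G.Derives ev' B d' ↔ ∃ d, G.Derives ev B d ∧ d.map φ = d' := by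
  constructor
  · intro h
    induction h with
    | rule r hr g' _ ih =>
      choose! f hf hfg using ih
      have hK B (hB : B ∈ r.links) : B ∈ G.big := G.links_big r hr hB
      obtain ⟨g, hg⟩ := exists_map_eq_of_disjoint (fun B hB => G.big_nodup B (hK B hB))
        (G.links_disjoint r hr) fun B hB => (hf B hB).length_eq
      have hd : ∀ B ∈ r.links, G.Derives ev B (B.map g) := fun B hB => by
        rw [hg B hB]
        exact hf B hB
      refine ⟨_, .rule r hr g hd, ?_⟩
      rw [List.map_map]
      refine List.map_congr_left fun t ht => (hφ g g' t fun C hC => ?_).symm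
      refine forall_nonterminals hr (P := fun C c => Q (G.rkN C) c ∧ g' C = φ c)
        (fun B hB => ?_) t ht C hC
      have h1 := (hd B hB).forall₂ hQ
      have h2 := hfg B hB
      rw [← hg B hB, List.map_map, List.map_inj_left] at h2
      rw [List.forall₂_map_right_iff, List.forall₂_same] at h1 ⊢
      exact fun C hC => ⟨h1 C hC, (h2 C hC).symm⟩
  · rintro ⟨d, h, rfl⟩
    induction h with
    | rule r hr g hg ih =>
      rw [List.map_map]
      convert Derives.rule (ev := ev') r hr (φ ∘ g) fun B hB => by
        rw [← List.map_map]
        exact ih B hB using 1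
      refine List.map_congr_left fun t ht => (hφ g (φ ∘ g) t fun C hC => ⟨?_, rfl⟩).symm
      exact forall_nonterminals hr (P := fun C => Q (G.rkN C))
        (fun B hB => (hg B hB).forall₂ hQ) t ht C hC

end MCFTG

/-! ### Interpretation of grammars in strings -/

/-- The string contributed to the yield by a terminal. -/
def yieldSymbol (T : RankedAlphabet A) (s : T.symbols) : List A :=
  if T.rank s = 0 then s.1.toList else []

theorem treeYield_eq (t : T.Trees) : treeYield T t = t.labels.flatMap (yieldSymbol T) := by
  rw [treeYield, List.filterMap_eq_flatMap_toList]
  refine List.flatMap_congr fun s _ => ?_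
  rw [yieldSymbol]
  split_ifs <;> rfl

/-- Interpretation of trees as strings with variables, by their yields. -/
def yieldString (T : RankedAlphabet A) (s : T.symbols) : VString A :=
  (yieldSymbol T s).map .inl ++ (List.range (T.rank s)).map .inr

theorem svars_yieldString (s : T.symbols) : svars (yieldString T s) = List.range (T.rank s) := by
  simp [yieldString]

theorem svars_flat_yieldString_perm (t : T.Trees) :
    (svars (t.flat (yieldString T))).Perm t.vars :=
  RTree.svars_flat_perm fun s _ => by rw [svars_yieldString]

variable {N : Type} {rkN : N → ℕ}

/-- The value in `VString A` of a tree with nonterminals. -/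
def flatEval (g : N → VString A) (t : RTree (sumRank T rkN)) : VString A :=
  t.flat (Sum.elim g (yieldString T))

theorem flat_replace (g : N → T.Trees) (t : RTree (sumRank T rkN)) :
    (replace g t).flat (yieldString T) = flatEval (fun C => (g C).flat (yieldString T)) t := by
  rw [replace, RTree.flat_hom (fun s i hi => by simpa [svars_yieldString] using hi)]
  refine RTree.flat_congr fun s _ => ?_
  cases s with
  | inl C => rfl
  | inr s => exact RTree.flat_init s

theorem svars_flatEval_perm {g : N → VString A} {t : RTree (sumRank T rkN)}
    (h : ∀ C, Sum.inl C ∈ t.labels → (svars (g C)).Perm (List.range (rkN C))) :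
    (svars (flatEval g t)).Perm t.vars := by
  refine RTree.svars_flat_perm fun s hs => ?_
  cases s with
  | inl C => exact h C hs
  | inr s => simp [svars_yieldString]

/-- Variables are counted on strings: flattening keeps them up to order and turns `replace` into
`flatEval`. -/
theorem vars_replace_perm {g : N → T.Trees} {t : RTree (sumRank T rkN)}
    (h : ∀ C, Sum.inl C ∈ t.labels → (g C).IsPattern (rkN C)) :
    (replace g t).vars.Perm t.vars := by
  refine (svars_flat_yieldString_perm _).symm.trans ?_
  rw [flat_replace]
  exact svars_flatEval_perm fun C hC => (svars_flat_yieldString_perm _).trans (h C hC)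

namespace MCFTG

variable {G : MCFTG T}

theorem preserves_isPattern :
    Preserves (G := G) replace fun k t => t.IsPattern k :=
  fun _ _ _ ht h => (vars_replace_perm h).trans ht

theorem preserves_svars :
    Preserves (G := G) flatEval fun k d => (svars d).Perm (List.range k) :=
  fun _ _ _ ht h => (svars_flatEval_perm h).trans ht

theorem derives_flatEval_iff {B : List G.N} {d : List (VString A)} :
    G.Derives flatEval B d ↔
      ∃ l, G.Generates B l ∧ l.map (fun t => t.flat (yieldString T)) = d := by
  simp only [generates_iff_derives]
  have : Nonempty T.Trees := ⟨.var 0⟩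
  -- No invariant is needed: `flat_replace` holds for arbitrary values of the nonterminals.
  refine derives_map_iff (Q := fun _ _ => True) (fun _ _ _ _ _ => trivial) fun g g' t h => ?_
  rw [flat_replace]
  refine RTree.flat_congr fun s hs => ?_
  cases s with
  | inl C => exact (h C hs).2
  | inr s => rfl

theorem mem_treeYield_image_iff {w : List A} :
    w ∈ treeYield T '' G.treeLanguage ↔ ∃ d, G.Derives flatEval [G.S] [d] ∧ ssyms d = w := by
  have key (t : T.Trees) : ssyms (t.flat (yieldString T)) = treeYield T t := by
    rw [treeYield_eq]
    exact RTree.ssyms_flat _ t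
  constructor
  · rintro ⟨t, ht, rfl⟩
    exact ⟨_, derives_flatEval_iff.2 ⟨[t], ht, rfl⟩, key t⟩
  · rintro ⟨d, hd, rfl⟩
    obtain ⟨l, hl, h⟩ := derives_flatEval_iff.1 hd
    obtain ⟨t, rfl, rfl⟩ := List.map_eq_singleton_iff.1 h
    exact ⟨t, hl, (key t).symm⟩

end MCFTG

/-! ### Interpretation of grammars by strings of labels -/

/-- The value in `List A` of a tree with nonterminals, if the nonterminals `C` stand for `g C` and
the terminals `s` for `f s`. -/
def labelEval (f : T.symbols → List A) (g : N → List A) (t : RTree (sumRank T rkN)) : List A :=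
  t.labels.flatMap (Sum.elim g f)

/-- The first-order substitution into `t` only appends labels to the right. -/
def AppendsLabels (t : T.Trees) : Prop :=
  ∀ f : ℕ → T.Trees, (t.bind f).labels = t.labels ++ t.vars.flatMap fun i => (f i).labels

/-- A node has at most one subtree, so nothing stands to the right of a variable. -/
theorem appendsLabels_of_rank_le_one (hT : ∀ s, T.rank s ≤ 1) (t : T.Trees) :
    AppendsLabels t := by
  intro f
  induction t with
  | var i => simp [RTree.bind, RTree.labels, RTree.vars]
  | node s t ih =>
    simp only [RTree.bind, RTree.labels, RTree.vars]
    have := hT s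
    generalize T.rank s = k at t this
    interval_cases k <;> simp [ih]

theorem bind_of_vars_eq_nil {S : Type u} {rk : S → ℕ} {t : RTree rk} (ht : t.vars = [])
    (f : ℕ → RTree rk) : t.bind f = t := by
  induction t with
  | var i => simp [RTree.vars] at ht
  | node s t ih =>
    simp only [RTree.vars, List.flatten_eq_nil_iff, List.mem_ofFn] at ht
    rw [RTree.bind]
    congr 1
    funext i
    exact ih i (ht _ ⟨i, rfl⟩)

/-- The subtrees below `C` are plugged into the variables of `g C`. These come in increasing order
and substitution only appends, so in prefix notation `g C` simply replaces the letter `C`. -/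
theorem labels_replace {g : N → T.Trees} (f : T.symbols → List A) {t : RTree (sumRank T rkN)}
    (h : ∀ C, Sum.inl C ∈ t.labels → AppendsLabels (g C) ∧ (g C).vars = List.range (rkN C)) :
    (replace g t).labels.flatMap f = labelEval f (fun C => (g C).labels.flatMap f) t := by
  induction t with
  | var i => rfl
  | node s t ih =>
    have ih' i := ih i fun C hC => h C (RTree.mem_labels_node.2 (.inr ⟨i, hC⟩))
    have hs : (replace g (.node s t)).labels.flatMap f =
        Sum.elim (fun C => (g C).labels.flatMap f) f s ++
          (List.ofFn fun i => (replace g (t i)).labels.flatMap f).flatten := by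
      cases s with
      | inl C =>
        obtain ⟨h1, h2⟩ := h C (RTree.mem_labels_node.2 (.inl rfl))
        replace h2 : (g C).vars = List.range (sumRank T rkN (.inl C)) := h2
        rw [replace, RTree.hom, Sum.elim_inl, h1, h2]
        simp only [apply_dite RTree.labels]
        rw [flatMap_range_dite fun i => ((t i).hom (Sum.elim g RTree.init)).labels, List.flatMap_append,
          flatMap_flatten, List.map_ofFn]
        rfl
      | inr s =>
        simp only [replace, RTree.hom, Sum.elim_inr, RTree.init, RTree.bind, RTree.labels,
          List.flatMap_cons, flatMap_flatten, List.map_ofFn]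
        congr 3
        funext i
        simp
    rw [hs, labelEval, RTree.labels, List.flatMap_cons, flatMap_flatten, List.map_ofFn]
    congr 4
    funext i
    exact ih' i

namespace MCFTG

variable {G : MCFTG T}

theorem derives_labelEval_iff
    (hG : ∀ C (t : T.Trees), t.IsPattern (G.rkN C) →
      AppendsLabels t ∧ t.vars = List.range (G.rkN C))
    (f : T.symbols → List A) {B : List G.N} {d : List (List A)} :
    G.Derives (labelEval f) B d ↔
      ∃ l, G.Generates B l ∧ l.map (fun t => t.labels.flatMap f) = d := by
  simp only [generates_iff_derives]
  have : Nonempty T.Trees := ⟨.var 0⟩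
  refine derives_map_iff preserves_isPattern fun g g' t h => ?_
  rw [labels_replace f fun C hC => hG C _ (h C hC).1]
  refine List.flatMap_congr fun s hs => ?_
  cases s with
  | inl C => exact (h C hs).2
  | inr s => rfl

theorem IsMRTG.derives_labelEval_iff (hG : G.IsMRTG) (f : T.symbols → List A) {B : List G.N}
    {d : List (List A)} :
    G.Derives (labelEval f) B d ↔
      ∃ l, G.Generates B l ∧ l.map (fun t => t.labels.flatMap f) = d := by
  refine MCFTG.derives_labelEval_iff (fun C t ht => ?_) f
  rw [hG C] at ht ⊢
  have ht' : t.vars = [] := List.perm_nil.1 ht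
  exact ⟨fun f => by simp [bind_of_vars_eq_nil ht', ht'], ht'⟩

theorem IsMRTG.mem_treeYield_image_iff (hG : G.IsMRTG) {w : List A} :
    w ∈ treeYield T '' G.treeLanguage ↔ G.Derives (labelEval (yieldSymbol T)) [G.S] [w] := by
  rw [hG.derives_labelEval_iff]
  constructor
  · rintro ⟨t, ht, rfl⟩
    exact ⟨[t], ht, by simp [treeYield_eq]⟩
  · rintro ⟨l, hl, h⟩
    obtain ⟨t, rfl, rfl⟩ := List.map_eq_singleton_iff.1 h
    exact ⟨t, hl, treeYield_eq t⟩

theorem IsMCFG.rank_le_one (hG : G.IsMCFG) (s : T.symbols) : T.rank s ≤ 1 := by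
  obtain ⟨_ | a, hs⟩ := s
  · simp [T.rank_e hs]
  · simp [hG.rank_letter a hs]

theorem IsMCFG.derives_labelEval_iff (hG : G.IsMCFG) (f : T.symbols → List A) {B : List G.N}
    {d : List (List A)} :
    G.Derives (labelEval f) B d ↔
      ∃ l, G.Generates B l ∧ l.map (fun t => t.labels.flatMap f) = d := by
  refine MCFTG.derives_labelEval_iff (fun C t ht =>
    ⟨appendsLabels_of_rank_le_one hG.rank_le_one t, ?_⟩) f
  by_cases hC : C = G.S
  · subst hC
    rw [G.S_rank] at ht ⊢
    exact List.perm_nil.1 ht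
  · rw [hG.rank_nonterminal C hC] at ht ⊢
    exact List.perm_singleton.1 ht

/-- A closed tree over this alphabet is a path of letters whose only leaf is `e`. -/
theorem IsMCFG.labels_eq (hG : G.IsMCFG) {t : T.Trees} (ht : t.vars = []) :
    t.labels.map Subtype.val = (t.labels.flatMap fun s => s.1.toList).map some ++ [none] := by
  induction t with
  | var i => simp [RTree.vars] at ht
  | node s t ih =>
    obtain ⟨_ | a, hs⟩ := s
    · simp [RTree.labels_node_of_rank_eq_zero (T.rank_e hs)]
    · rw [RTree.vars_node_of_rank_eq_one (hG.rank_letter a hs)] at ht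
      simp [RTree.labels_node_of_rank_eq_one (hG.rank_letter a hs), ih _ ht]

theorem IsMCFG.mem_stringLanguage_iff (hG : G.IsMCFG) {w : List A} :
    w ∈ G.stringLanguage ↔ G.Derives (labelEval fun s => s.1.toList) [G.S] [w] := by
  rw [hG.derives_labelEval_iff]
  have key (t : T.Trees) (ht : G.Generates [G.S] [t]) :
      t.labels.map Subtype.val = w.map some ++ [none] ↔
        (t.labels.flatMap fun s => s.1.toList) = w := by
    have h := (generates_iff_derives.1 ht).forall₂ preserves_isPattern
    simp only [List.forall₂_cons, List.Forall₂.nil, and_true, G.S_rank] at h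
    rw [hG.labels_eq (List.perm_nil.1 h), List.append_left_inj]
    exact (List.map_injective_iff.2 (Option.some_injective A)).eq_iff
  constructor
  · rintro ⟨t, ht, h⟩
    exact ⟨[t], ht, by simpa using (key t ht).1 h⟩
  · rintro ⟨l, hl, h⟩
    obtain ⟨t, rfl, h⟩ := List.map_eq_singleton_iff.1 h
    exact ⟨t, hl, (key t hl).2 (by simpa using h)⟩

end MCFTG

end Derives

/-! ### Every multiple context-free language is a yield of a multiple regular tree language -/

section Regular

variable {A : Type u} (T : RankedAlphabet A)

open Classical in
/-- The alphabet with the additional binary symbol `c`, the symbol `e`, and the symbols of `T`,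
all of which have rank `0`. -/
noncomputable def combAlphabet (c : A) : RankedAlphabet A where
  symbols := insert none (insert (some c) T.symbols)
  rank s := if s.1 = some c then 2 else 0
  rank_e _ := by simp

variable (c : A)

def combEnd : (combAlphabet T c).symbols := ⟨none, by simp [combAlphabet]⟩

def combNode : (combAlphabet T c).symbols := ⟨some c, by simp [combAlphabet]⟩

variable {T} in
def combLeaf (s : T.symbols) : (combAlphabet T c).symbols :=
  ⟨s.1, by simp [combAlphabet]⟩

variable {N : Type} {rkN : N → ℕ}

theorem rank_combEnd : sumRank (combAlphabet T c) rkN (.inr (combEnd T c)) = 0 := by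
  simp [combAlphabet, combEnd]

theorem rank_combNode : sumRank (combAlphabet T c) rkN (.inr (combNode T c)) = 2 := by
  simp [combAlphabet, combNode]

variable {T} {c}

theorem rank_combLeaf (hc : some c ∉ T.symbols) (s : T.symbols) :
    (combAlphabet T c).rank (combLeaf c s) = 0 := by
  have : s.1 ≠ some c := fun h => hc (h ▸ s.2)
  simp [combAlphabet, combLeaf, this]

theorem rank_map_combLeaf (hc : some c ∉ T.symbols) (s : N ⊕ T.symbols) :
    sumRank (combAlphabet T c) (fun _ : N => 0) (s.map id (combLeaf c)) = 0 := by
  cases s with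
  | inl C => rfl
  | inr s => exact rank_combLeaf hc s

theorem yieldSymbol_combEnd : yieldSymbol (combAlphabet T c) (combEnd T c) = [] := by
  rw [yieldSymbol]
  split_ifs <;> rfl

theorem yieldSymbol_combNode : yieldSymbol (combAlphabet T c) (combNode T c) = [] := by
  rw [yieldSymbol, if_neg]
  simp [combAlphabet, combNode]

theorem yieldSymbol_combLeaf (hc : some c ∉ T.symbols) (s : T.symbols) :
    yieldSymbol (combAlphabet T c) (combLeaf c s) = s.1.toList := by
  rw [yieldSymbol, if_pos (rank_combLeaf hc s)]
  rfl

variable (c)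

/-- The comb whose leaves have the given labels, followed by `e`. -/
def comb : List (N ⊕ T.symbols) → RTree (sumRank (combAlphabet T c) fun _ : N => 0)
  -- `.var 0` is a dummy, here and below a leaf: nodes of rank 0 have no children.
  | [] => .node (.inr (combEnd T c)) fun _ => .var 0
  | s :: l => .node (.inr (combNode T c)) fun i =>
      if i.1 = 0 then .node (s.map id (combLeaf c)) fun _ => .var 0 else comb l

variable {c}

theorem vars_comb (hc : some c ∉ T.symbols) (l : List (N ⊕ T.symbols)) :
    (comb c l).vars = [] := by
  induction l with
  | nil => exact RTree.vars_node_of_rank_eq_zero (rank_combEnd T c)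
  | cons s l ih =>
    rw [comb, RTree.vars_node_of_rank_eq_two (rank_combNode T c)]
    simp [ih, RTree.vars_node_of_rank_eq_zero (rank_map_combLeaf hc s)]

theorem labels_comb (hc : some c ∉ T.symbols) (l : List (N ⊕ T.symbols)) :
    (comb c l).labels =
      (l.flatMap fun s => [.inr (combNode T c), s.map id (combLeaf c)]) ++
        [.inr (combEnd T c)] := by
  induction l with
  | nil => exact RTree.labels_node_of_rank_eq_zero (rank_combEnd T c)
  | cons s l ih =>
    rw [comb, RTree.labels_node_of_rank_eq_two (rank_combNode T c)]
    simp [ih, RTree.labels_node_of_rank_eq_zero (rank_map_combLeaf hc s)]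

theorem nonterminals_map_comb (hc : some c ∉ T.symbols) (l : List (RTree (sumRank T rkN))) :
    nonterminals (l.map fun t => comb c t.labels) = nonterminals l := by
  rw [nonterminals, List.flatMap_map]
  refine List.flatMap_congr fun t _ => ?_
  rw [labels_comb hc]
  induction t.labels with
  | nil => rfl
  | cons s l ih =>
    rw [List.filterMap_append] at ih
    cases s <;> simpa [List.filterMap_cons] using ih

theorem labelEval_comb (hc : some c ∉ T.symbols) (g : N → List A)
    (t : RTree (sumRank T rkN)) :
    labelEval (yieldSymbol (combAlphabet T c)) g (comb c t.labels) =
      labelEval (fun s => s.1.toList) g t := by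
  rw [labelEval, labelEval, labels_comb hc]
  induction t.labels with
  | nil => simp [yieldSymbol_combEnd]
  | cons s l ih =>
    cases s <;> simp_all [yieldSymbol_combNode, yieldSymbol_combLeaf hc]

/-- The multiple regular tree grammar whose right-hand sides are combs of the labels of the
right-hand sides of `G`. -/
def MCFTG.combGrammar (G : MCFTG T) (hc : some c ∉ T.symbols) : MCFTG (combAlphabet T c) where
  N := G.N
  finite_N := G.finite_N
  rkN _ := 0
  big := G.big
  finite_big := G.finite_big
  big_ne_nil := G.big_ne_nil
  big_nodup := G.big_nodup
  big_inj := G.big_inj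
  exists_rank_pos := ⟨combNode T c, by simp [combAlphabet, combNode]⟩
  S := G.S
  S_big := G.S_big
  S_rank := rfl
  rules := (fun r => ⟨r.lhs, r.rhs.map fun t => comb c t.labels, r.links⟩) '' G.rules
  finite_rules := G.finite_rules.image _
  lhs_big := by
    rintro _ ⟨r, hr, rfl⟩
    exact G.lhs_big r hr
  rhs_pattern := by
    rintro _ ⟨r, hr, rfl⟩
    simp only [List.forall₂_map_right_iff]
    refine (G.rhs_pattern r hr).imp fun C t _ => ?_
    rw [RTree.IsPattern, vars_comb hc]
    rfl
  rhs_unique := by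
    rintro _ ⟨r, hr, rfl⟩
    rw [nonterminals_map_comb hc]
    exact G.rhs_unique r hr
  links_big := by
    rintro _ ⟨r, hr, rfl⟩
    exact G.links_big r hr
  links_cover := by
    rintro _ ⟨r, hr, rfl⟩
    rw [nonterminals_map_comb hc]
    exact G.links_cover r hr
  links_disjoint := by
    rintro _ ⟨r, hr, rfl⟩
    exact G.links_disjoint r hr

/-- A comb evaluates to the same string as the tree whose labels it carries, so the two grammars
have the same rule instances. -/
theorem MCFTG.combGrammar_derives_iff (G : MCFTG T) (hc : some c ∉ T.symbols) {B : List G.N}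
    {d : List (List A)} :
    (G.combGrammar hc).Derives (labelEval (yieldSymbol (combAlphabet T c))) B d ↔
      G.Derives (labelEval fun s => s.1.toList) B d := by
  have key (r : Rule T G.rkN) (g : G.N → List A) :
      (r.rhs.map fun t => comb c t.labels).map (labelEval (yieldSymbol (combAlphabet T c)) g) =
        r.rhs.map (labelEval (fun s => s.1.toList) g) := by
    rw [List.map_map]
    exact List.map_congr_left fun t _ => labelEval_comb hc g t
  constructor
  · refine fun h => Derives.rec (G := G.combGrammar hc)
      (motive := fun B d _ => G.Derives (labelEval fun s => s.1.toList) B d)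
      (fun r' hr' g _ ih => ?_) h
    obtain ⟨r, hr, rfl⟩ := hr'
    exact key r g ▸ Derives.rule (G := G) r hr g ih
  · intro h
    induction h with
    | rule r hr g _ ih =>
      exact key r g ▸ Derives.rule (G := G.combGrammar hc)
        (ev := labelEval (yieldSymbol (combAlphabet T c))) _ ⟨r, hr, rfl⟩ g ih

theorem MCF_subset_yieldClass_MRT (A : Type u) [Infinite A] : MCF A ⊆ yieldClass (MRT A) := by
  classical
  rintro _ ⟨T, G, hG, rfl⟩
  -- The binary symbol must be fresh, since the letters of `T` become leaves; this is where an
  -- infinite supply of symbols is used.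
  obtain ⟨c, hc⟩ := Infinite.exists_notMem_finset T.symbols.eraseNone
  rw [Finset.mem_eraseNone] at hc
  have hM : (G.combGrammar hc).IsMRTG := fun _ => rfl
  refine ⟨_, _, ⟨G.combGrammar hc, hM, rfl⟩, Set.ext fun w => ?_⟩
  exact hM.mem_treeYield_image_iff.trans <|
    (G.combGrammar_derives_iff hc).trans hG.mem_stringLanguage_iff.symm

theorem yieldClass_MRT_subset_yieldClass_MCFT (A : Type u) :
    yieldClass (MRT A) ⊆ yieldClass (MCFT A) := by
  rintro _ ⟨T, _, ⟨G, _, rfl⟩, rfl⟩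
  exact ⟨T, _, ⟨G, rfl⟩, rfl⟩

end Regular

/-! ### Every yield of a multiple context-free tree language is multiple context-free -/

section Strings

variable {A : Type u}

/-- The possible orders of `k` variables. -/
abbrev VarOrder (k : ℕ) : Type := {p : List ℕ // p.Perm (List.range k)}

instance (k : ℕ) : Finite (VarOrder k) :=
  Set.Finite.to_subtype <| (List.finite_toSet (List.range k).permutations).subset fun _ hp =>
    List.mem_permutations.2 hp

/-- The order of variables given by a list. -/
noncomputable def VarOrder.ofList (k : ℕ) (p : List ℕ) : VarOrder k :=
  -- The increasing order is a default for lists that are not permutations.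
  open Classical in if h : p.Perm (List.range k) then ⟨p, h⟩ else ⟨List.range k, .refl _⟩

theorem VarOrder.ofList_val {k : ℕ} {p : List ℕ} (h : p.Perm (List.range k)) :
    (VarOrder.ofList k p).1 = p := by
  simp [ofList, h]

open Classical in
/-- The monadic alphabet with end marker `e` that has the letters of `T`. -/
noncomputable def monadicAlphabet (T : RankedAlphabet A) : RankedAlphabet A where
  symbols := insert none T.symbols
  rank s := if s.1 = none then 0 else 1
  rank_e _ := by simp

/-- The letter of the monadic alphabet for a symbol of `T`. -/
def monadicLetter {T : RankedAlphabet A} (s : T.symbols) : (monadicAlphabet T).symbols :=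
  ⟨s.1, by simp [monadicAlphabet]⟩

/-! ### Splitting nonterminals into segments -/

section Segments

variable {N : Type} (rkN : N → ℕ)

/-- Nonterminals with an order of their variables. -/
abbrev Ordered : Type := Σ C : N, VarOrder (rkN C)

/-- Nonterminals that generate one segment of the string generated by an ordered nonterminal. -/
abbrev Segment : Type := Σ l : Ordered rkN, Fin (rkN l.1 + 1)

variable {rkN}

def block (l : Ordered rkN) : List (Segment rkN) :=
  (List.finRange (rkN l.1 + 1)).map fun j => ⟨l, j⟩

/-- The big nonterminal formed by all segments of `L`; `none` is reserved for the new initial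
nonterminal. -/
def expand (L : List (Ordered rkN)) : List (Option (Segment rkN)) :=
  (L.flatMap block).map some

theorem mem_block {l : Ordered rkN} {n : Segment rkN} : n ∈ block l ↔ n.1 = l := by
  constructor
  · simp only [block, List.mem_map]
    rintro ⟨j, _, rfl⟩
    rfl
  · rintro rfl
    simp [block]

theorem length_block (l : Ordered rkN) : (block l).length = rkN l.1 + 1 := by
  simp [block]

theorem block_of_rank_eq_zero {l : Ordered rkN} (h : rkN l.1 = 0) : block l = [⟨l, 0⟩] := by
  obtain ⟨n, hn⟩ := List.length_eq_one_iff.1 ((length_block l).trans (by rw [h]))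
  have : (⟨l, 0⟩ : Segment rkN) ∈ block l := mem_block.2 rfl
  rw [hn, List.mem_singleton] at this
  rw [hn, this]

theorem mem_expand {L : List (Ordered rkN)} {n : Option (Segment rkN)} :
    n ∈ expand L ↔ ∃ m : Segment rkN, m.1 ∈ L ∧ n = some m := by
  simp only [expand, List.mem_map, List.mem_flatMap, mem_block]
  constructor
  · rintro ⟨m, ⟨l, hl, rfl⟩, rfl⟩
    exact ⟨m, hl, rfl⟩
  · rintro ⟨m, hm, rfl⟩
    exact ⟨m, ⟨_, hm, rfl⟩, rfl⟩

theorem none_notMem_expand (L : List (Ordered rkN)) : none ∉ expand L := by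
  simp [expand]

theorem expand_ne_nil {L : List (Ordered rkN)} (h : L ≠ []) : expand L ≠ [] := by
  obtain ⟨l, L, rfl⟩ := List.exists_cons_of_ne_nil h
  exact List.ne_nil_of_mem (mem_expand.2 ⟨⟨l, 0⟩, by simp, rfl⟩)

theorem expand_nodup {L : List (Ordered rkN)} (h : (L.map Sigma.fst).Nodup) :
    (expand L).Nodup := by
  refine List.Nodup.map (Option.some_injective _) (List.nodup_flatMap.2 ⟨fun l _ => ?_, ?_⟩)
  · exact (List.nodup_finRange _).map fun i j hij => by simpa using hij
  · refine (List.Nodup.of_map _ h).imp fun {l l'} hne n hn hn' => hne ?_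
    exact (mem_block.1 hn).symm.trans (mem_block.1 hn')

/-- Even a nonterminal of rank 0 has a segment with index 0, which witnesses membership of `l`. -/
theorem mem_iff_of_expand {L L' : List (Ordered rkN)}
    (h : ∀ n, n ∈ expand L ↔ n ∈ expand L') (l : Ordered rkN) : l ∈ L ↔ l ∈ L' := by
  have key (M : List (Ordered rkN)) : some ⟨l, 0⟩ ∈ expand M ↔ l ∈ M := by
    rw [mem_expand]
    constructor
    · rintro ⟨m, hm, h⟩
      cases h
      exact hm
    · exact fun hl => ⟨_, hl, rfl⟩
  rw [← key, ← key, h]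

/-- Each nonterminal occurs only once in `L`, so `L` contains only one order for it. -/
theorem eq_of_map_fst_eq {L L' : List (Ordered rkN)} (h : L.map Sigma.fst = L'.map Sigma.fst)
    (hL : (L.map Sigma.fst).Nodup) (hm : ∀ l ∈ L', l ∈ L) : L = L' := by
  have hlen : L.length = L'.length := by simpa using congrArg List.length h
  refine List.ext_getElem hlen fun i hi hi' => ?_
  refine List.inj_on_of_nodup_map hL (List.getElem_mem hi) (hm _ (List.getElem_mem hi')) ?_
  simpa [hi, hi'] using congrArg (·[i]?) h

variable {T : RankedAlphabet A}

/-- Rank function of the segments (rank `1`) and the initial nonterminal `none` (rank `0`). -/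
def segmentRank (n : Option (Segment rkN)) : ℕ := if n.isSome then 1 else 0

/-- The monadic tree for a string, where occurrences of `e` are omitted. -/
noncomputable def monadicTree : List (Segment rkN ⊕ (monadicAlphabet T).symbols) →
    RTree (sumRank (monadicAlphabet T) (segmentRank (rkN := rkN)))
  | [] => .var 0
  | .inl n :: l => .node (.inl (some n)) fun _ => monadicTree l
  -- A node `e` would cut off the final variable; omitting it does not change the string.
  | .inr s :: l => if s.1 = none then monadicTree l else .node (.inr s) fun _ => monadicTree l

theorem rank_monadic {s : (monadicAlphabet T).symbols} (hs : s.1 ≠ none) :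
    sumRank (monadicAlphabet T) (segmentRank (rkN := rkN)) (.inr s) = 1 :=
  if_neg hs

theorem rank_segment (n : Segment rkN) :
    sumRank (monadicAlphabet T) (segmentRank (rkN := rkN)) (.inl (some n)) = 1 :=
  rfl

theorem vars_monadicTree (l : List (Segment rkN ⊕ (monadicAlphabet T).symbols)) :
    (monadicTree l).vars = [0] := by
  induction l with
  | nil => rfl
  | cons x l ih =>
    obtain n | s := x
    · exact (RTree.vars_node_of_rank_eq_one (rank_segment n)).trans ih
    · rw [monadicTree]
      split_ifs with hs
      · exact ih
      · exact (RTree.vars_node_of_rank_eq_one (rank_monadic hs)).trans ih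

theorem nonterminals_monadicTree (l : List (Segment rkN ⊕ (monadicAlphabet T).symbols)) :
    (monadicTree l).labels.filterMap Sum.getLeft? = (l.filterMap Sum.getLeft?).map some := by
  induction l with
  | nil => rfl
  | cons x l ih =>
    obtain n | s := x
    · rw [monadicTree, RTree.labels_node_of_rank_eq_one (rank_segment n)]
      simp [ih]
    · rw [monadicTree]
      split_ifs with hs
      · simpa [List.filterMap_cons] using ih
      · rw [RTree.labels_node_of_rank_eq_one (rank_monadic hs)]
        simpa [List.filterMap_cons] using ih

/-- The substitution of strings for segments. -/
def segmentSubst (g : Option (Segment rkN) → List A) :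
    Segment rkN ⊕ (monadicAlphabet T).symbols → List A :=
  Sum.elim (fun n => g (some n)) fun s => s.1.toList

theorem labelEval_monadicTree (g : Option (Segment rkN) → List A)
    (l : List (Segment rkN ⊕ (monadicAlphabet T).symbols)) :
    labelEval (fun s => s.1.toList) g (monadicTree l) = l.flatMap (segmentSubst g) := by
  induction l with
  | nil => rfl
  | cons x l ih =>
    rw [labelEval] at ih ⊢
    obtain n | s := x
    · rw [monadicTree, RTree.labels_node_of_rank_eq_one (rank_segment n)]
      simp [segmentSubst, ih]
    · rw [monadicTree]
      split_ifs with hs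
      · simp [segmentSubst, ih, hs]
      · rw [RTree.labels_node_of_rank_eq_one (rank_monadic hs)]
        simp [segmentSubst, ih]

variable (q : ∀ C, VarOrder (rkN C))

/-- The nonterminals `C` are interpreted by their segments, separated by variables in the order
`q C`. -/
noncomputable def emit :
    N ⊕ T.symbols → VString (Segment rkN ⊕ (monadicAlphabet T).symbols)
  | .inl C => interleave (q C).1 ((block ⟨C, q C⟩).map fun n => [.inl n])
  | .inr s =>
      (if T.rank s = 0 then [.inr (monadicLetter s)] else []).map .inl ++
        (List.range (T.rank s)).map .inr

theorem svars_emit_perm (s : N ⊕ T.symbols) :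
    (svars (emit q s)).Perm (List.range (sumRank T rkN s)) := by
  cases s with
  | inl C => simpa [emit, svars_interleave] using (q C).2
  | inr s => simp [emit]

theorem ssyms_emit (s : N ⊕ T.symbols) :
    (ssyms (emit q s)).filterMap Sum.getLeft? =
      s.elim (fun C => block ⟨C, q C⟩) fun _ => [] := by
  cases s with
  | inl C =>
    rw [emit, ssyms_interleave]
    · rw [← List.flatMap_def, List.filterMap_flatMap]
      simp
    · simp [length_block, (q C).2.length_eq]
  | inr s =>
    simp only [emit, ssyms_append, ssyms_map_inl, ssyms_map_inr]
    split_ifs <;> simp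

/-- The string of a tree with nonterminals split into segments. -/
noncomputable def segmentString (t : RTree (sumRank T rkN)) :
    VString (Segment rkN ⊕ (monadicAlphabet T).symbols) :=
  t.flat (emit q)

theorem svars_segmentString_perm (t : RTree (sumRank T rkN)) :
    (svars (segmentString q t)).Perm t.vars :=
  RTree.svars_flat_perm fun s _ => svars_emit_perm q s

/-- The strings for the nonterminals that are given by the strings for their segments. -/
def joinSegments (g : Option (Segment rkN) → List A) (C : N) : VString A :=
  interleave (q C).1 ((block ⟨C, q C⟩).map fun n => g (some n))

/-- Flattening commutes with substitution for symbols, so segments can be kept symbolic and filled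
in later. -/
theorem smap_segmentString (g : Option (Segment rkN) → List A) (t : RTree (sumRank T rkN)) :
    smap (segmentSubst g) (segmentString q t) = flatEval (joinSegments q g) t := by
  rw [segmentString, RTree.smap_flat]
  refine RTree.flat_congr fun s _ => ?_
  cases s with
  | inl C => simp [emit, smap_interleave, joinSegments, Function.comp_def, segmentSubst]
  | inr s =>
    simp only [emit, smap_append, smap_map_inl, smap_map_inr, Sum.elim_inr, yieldString,
      yieldSymbol]
    split_ifs <;> simp [segmentSubst, monadicLetter]

/-- The order of the variables depends on `q` alone and not on the strings in the segments; hence a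
rule can fix it in its left-hand side. -/
theorem svars_segmentString (g : Option (Segment rkN) → List A) (t : RTree (sumRank T rkN)) :
    svars (segmentString q t) = svars (flatEval (joinSegments q g) t) := by
  rw [← smap_segmentString, svars_smap]

/-- The trees for the segments of the strings of a forest. -/
noncomputable def segmentTrees (l : List (RTree (sumRank T rkN))) :
    List (RTree (sumRank (monadicAlphabet T) (segmentRank (rkN := rkN)))) :=
  l.flatMap fun t => (segs (segmentString q t)).map monadicTree

theorem map_labelEval_segmentTrees (g : Option (Segment rkN) → List A)
    (l : List (RTree (sumRank T rkN))) :
    (segmentTrees q l).map (labelEval (fun s => s.1.toList) g) =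
      (l.map (flatEval (joinSegments q g))).flatMap segs := by
  rw [segmentTrees, List.map_flatMap, List.flatMap_map]
  refine List.flatMap_congr fun t _ => ?_
  rw [← smap_segmentString, segs_smap, List.map_map]
  exact List.map_congr_left fun l _ => labelEval_monadicTree g l

/-- Only up to order: strings of subtrees come between the segments of a nonterminal, possibly
permuted. -/
theorem nonterminals_segmentTrees_perm (l : List (RTree (sumRank T rkN))) :
    (nonterminals (segmentTrees q l)).Perm
      (expand ((nonterminals l).map fun C => ⟨C, q C⟩)) := by
  rw [segmentTrees, nonterminals, List.flatMap_assoc, nonterminals, expand, List.map_flatMap,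
    List.flatMap_map, List.flatMap_assoc]
  refine List.Perm.flatMap_left _ fun t _ => ?_
  have h1 : (((segs (segmentString q t)).map monadicTree).flatMap
      fun t => t.labels.filterMap Sum.getLeft?) =
        ((ssyms (segmentString q t)).filterMap Sum.getLeft?).map some := by
    rw [← flatten_segs, List.flatMap_map, List.filterMap_flatten, List.map_flatten, List.map_map,
      List.flatMap_def]
    simp only [nonterminals_monadicTree]
    rfl
  rw [h1, ← List.map_flatMap]
  refine List.Perm.map _ ?_
  refine ((RTree.ssyms_flat_perm fun s _ => svars_emit_perm q s).filterMap _).trans ?_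
  rw [List.filterMap_flatMap]
  simp only [ssyms_emit]
  refine .of_eq ?_
  induction t.labels with
  | nil => rfl
  | cons s l ih => cases s <;> simpa [List.filterMap_cons] using ih

end Segments

variable {T : RankedAlphabet A}

/-- The nonterminal `C` with the order of variables of the string `d`. -/
noncomputable def orderedBy {X : Type v} {N : Type} (rkN : N → ℕ) (C : N) (d : VString X) :
    Ordered rkN :=
  ⟨C, .ofList (rkN C) (svars d)⟩

theorem map_fst_zipWith_orderedBy {X : Type v} {N : Type} {rkN : N → ℕ} {B : List N}
    {d : List (VString X)} (h : B.length = d.length) :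
    (List.zipWith (orderedBy rkN) B d).map Sigma.fst = B := by
  rw [List.map_zipWith]
  simp only [orderedBy]
  induction B generalizing d with
  | nil => rfl
  | cons C B ih => cases d <;> simp_all

theorem zipWith_orderedBy_map {X : Type v} {N : Type} {rkN : N → ℕ} {B : List N}
    (g : N → VString X) :
    List.zipWith (orderedBy rkN) B (B.map g) =
      B.map fun C => ⟨C, .ofList (rkN C) (svars (g C))⟩ := by
  induction B <;> simp_all [orderedBy]

theorem flatEval_congr {N : Type} {rkN : N → ℕ} {g g' : N → VString A}
    {t : RTree (sumRank T rkN)} (h : ∀ C, Sum.inl C ∈ t.labels → g C = g' C) :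
    flatEval g t = flatEval g' t := by
  refine RTree.flat_congr fun s hs => ?_
  cases s with
  | inl C => exact h C hs
  | inr s => rfl

/-! ### The monadic grammar -/

namespace MCFTG

variable (G : MCFTG T)

/-- The rule for the segments of a rule `r` if the variables of the nonterminals `C` on the
right-hand side are in the order `q C`. -/
noncomputable def segmentRule (r : Rule T G.rkN) (q : ∀ C, VarOrder (G.rkN C)) :
    Rule (monadicAlphabet T) (segmentRank (rkN := G.rkN)) where
  lhs := expand (List.zipWith (fun C t => orderedBy G.rkN C (segmentString q t)) r.lhs r.rhs)
  rhs := segmentTrees q r.rhs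
  links := (fun B => expand (B.map fun C => ⟨C, q C⟩)) '' r.links

/-- The ordered initial nonterminal. -/
noncomputable def orderedStart : Ordered G.rkN := ⟨G.S, .ofList _ []⟩

noncomputable def monadicStartTree :
    RTree (sumRank (monadicAlphabet T) (segmentRank (rkN := G.rkN))) :=
  .node (.inl (some ⟨G.orderedStart, 0⟩)) fun _ =>
    .node (.inr ⟨none, by simp [monadicAlphabet]⟩) fun _ => .var 0

noncomputable def monadicStartRule :
    Rule (monadicAlphabet T) (segmentRank (rkN := G.rkN)) where
  lhs := [none]
  rhs := [G.monadicStartTree]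
  links := {expand [G.orderedStart]}

theorem vars_monadicStartTree : G.monadicStartTree.vars = [] :=
  (RTree.vars_node_of_rank_eq_one (rank_segment _)).trans
    (RTree.vars_node_of_rank_eq_zero ((monadicAlphabet T).rank_e _))

theorem labels_monadicStartTree : G.monadicStartTree.labels =
    [.inl (some ⟨G.orderedStart, 0⟩), .inr ⟨none, by simp [monadicAlphabet]⟩] :=
  (RTree.labels_node_of_rank_eq_one (rank_segment _)).trans
    (congrArg _ (RTree.labels_node_of_rank_eq_zero ((monadicAlphabet T).rank_e _)))

theorem nonterminals_monadicStartTree :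
    nonterminals [G.monadicStartTree] = [some ⟨G.orderedStart, 0⟩] := by
  simp [nonterminals, labels_monadicStartTree, List.filterMap_cons]

theorem expand_orderedStart : expand [G.orderedStart] = [some ⟨G.orderedStart, 0⟩] := by
  simp [expand, block_of_rank_eq_zero (l := G.orderedStart) G.S_rank]

/-- The big nonterminals of the monadic grammar. -/
def monadicBig : Set (List (Option (Segment G.rkN))) :=
  insert [none] (expand '' {L | L.map Sigma.fst ∈ G.big})

variable {G}

theorem map_fst_map_mk (q : ∀ C, VarOrder (G.rkN C)) (B : List G.N) :
    (B.map fun C => (⟨C, q C⟩ : Ordered G.rkN)).map Sigma.fst = B := by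
  simp [Function.comp_def]

theorem mem_expand_map {q : ∀ C, VarOrder (G.rkN C)} {B : List G.N}
    {n : Option (Segment G.rkN)} :
    n ∈ expand (B.map fun C => ⟨C, q C⟩) ↔ ∃ C ∈ B, ∃ j, n = some ⟨⟨C, q C⟩, j⟩ := by
  rw [mem_expand]
  simp only [List.mem_map]
  constructor
  · rintro ⟨⟨l, j⟩, ⟨C, hC, rfl⟩, rfl⟩
    exact ⟨C, hC, j, rfl⟩
  · rintro ⟨C, hC, j, rfl⟩
    exact ⟨_, ⟨C, hC, rfl⟩, rfl⟩

/-- `big_inj` fixes the underlying sequence, and its freeness from repetitions fixes the orders. -/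
theorem eq_of_expand {L L' : List (Ordered G.rkN)} (hL : L.map Sigma.fst ∈ G.big)
    (hL' : L'.map Sigma.fst ∈ G.big) (h : ∀ n, n ∈ expand L ↔ n ∈ expand L') : L = L' := by
  have hm := mem_iff_of_expand h
  refine eq_of_map_fst_eq (G.big_inj _ hL _ hL' fun C => ?_) (G.big_nodup _ hL) fun l hl =>
    (hm l).2 hl
  simp only [List.mem_map, hm]

theorem segmentRule_lhs_eq (r : Rule T G.rkN) (q : ∀ C, VarOrder (G.rkN C)) :
    (G.segmentRule r q).lhs =
      expand (List.zipWith (orderedBy G.rkN) r.lhs (r.rhs.map (segmentString q))) := by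
  simp [segmentRule, List.zipWith_map_right]

theorem map_fst_segmentRule {r : Rule T G.rkN} (hr : r ∈ G.rules)
    (q : ∀ C, VarOrder (G.rkN C)) :
    (List.zipWith (orderedBy G.rkN) r.lhs (r.rhs.map (segmentString q))).map Sigma.fst =
      r.lhs :=
  map_fst_zipWith_orderedBy (by simpa using (G.rhs_pattern r hr).length_eq)

/-- A `k`-ary right-hand side has `k` variables, hence `k + 1` segments, as many as the block of its
nonterminal. -/
theorem forall₂_segmentRule {r : Rule T G.rkN} (hr : r ∈ G.rules)
    (q : ∀ C, VarOrder (G.rkN C)) :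
    List.Forall₂ (fun n t => t.IsPattern (segmentRank n)) (G.segmentRule r q).lhs
      (G.segmentRule r q).rhs := by
  have h := G.rhs_pattern r hr
  rw [segmentRule_lhs_eq, segmentRule]
  dsimp only
  generalize r.lhs = B at h ⊢
  generalize r.rhs = l at h ⊢
  induction h with
  | nil => exact .nil
  | @cons C t B l ht _ ih =>
    rw [List.map_cons, List.zipWith_cons_cons, expand, List.flatMap_cons, List.map_append,
      segmentTrees, List.flatMap_cons]
    refine List.rel_append ?_ ih
    rw [List.forall₂_map_left_iff, List.forall₂_map_right_iff]
    refine List.forall₂_iff_zip.2 ⟨?_, fun _ => .of_eq (vars_monadicTree _)⟩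
    rw [length_block, length_segs, (svars_segmentString_perm q t).length_eq, ht.length_eq,
      List.length_range]
    rfl

variable (G) in
/-- The multiple context-free grammar that generates the yields of the trees generated by `G`. -/
noncomputable def monadicGrammar : MCFTG (monadicAlphabet T) where
  N := Option (Segment G.rkN)
  finite_N := by
    have := G.finite_N
    infer_instance
  rkN := segmentRank
  big := G.monadicBig
  finite_big := by
    have := G.finite_N
    -- Over each big nonterminal `B` lie only lists of length `B.length` over the finite type of
    -- ordered nonterminals.
    refine ((Set.Finite.subset (G.finite_big.biUnion fun B _ =>
      List.finite_length_eq (Ordered G.rkN) B.length) fun L hL => ?_).image _).insert _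
    exact Set.mem_biUnion hL (by simp)
  big_ne_nil := by
    rintro _ (rfl | ⟨L, hL, rfl⟩)
    · simp
    · refine expand_ne_nil fun h => G.big_ne_nil _ hL ?_
      rw [h, List.map_nil]
  big_nodup := by
    rintro _ (rfl | ⟨L, hL, rfl⟩)
    · simp
    · exact expand_nodup (G.big_nodup _ hL)
  big_inj := by
    rintro _ (rfl | ⟨L, hL, rfl⟩) _ (rfl | ⟨L', hL', rfl⟩) h
    · rfl
    · exact absurd ((h none).1 (by simp)) (none_notMem_expand _)
    · exact absurd ((h none).2 (by simp)) (none_notMem_expand _)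
    · rw [eq_of_expand hL hL' h]
  exists_rank_pos := by
    -- A terminal of positive rank is not `e`; it supplies a letter even if no letter has rank 0 in
    -- `T`.
    obtain ⟨⟨_ | a, hs⟩, h⟩ := G.exists_rank_pos
    · rw [T.rank_e hs] at h
      omega
    · exact ⟨monadicLetter ⟨some a, hs⟩, by simp [monadicAlphabet, monadicLetter]⟩
  S := none
  S_big := .inl rfl
  S_rank := rfl
  rules := insert G.monadicStartRule (⋃ q, (G.segmentRule · q) '' G.rules)
  finite_rules := by
    have := G.finite_N
    exact (Set.finite_iUnion fun q => G.finite_rules.image _).insert _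
  lhs_big := by
    rintro r' (rfl | hr')
    · exact .inl rfl
    · obtain ⟨q, r, hr, rfl⟩ := Set.mem_iUnion.1 hr'
      rw [segmentRule_lhs_eq]
      refine .inr ⟨_, ?_, rfl⟩
      rw [Set.mem_ofPred_eq, map_fst_segmentRule hr]
      exact G.lhs_big r hr
  rhs_pattern := by
    rintro r' (rfl | hr')
    · refine .cons ?_ .nil
      rw [RTree.IsPattern, vars_monadicStartTree]
      rfl
    · obtain ⟨q, r, hr, rfl⟩ := Set.mem_iUnion.1 hr'
      exact forall₂_segmentRule hr q
  rhs_unique := by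
    rintro r' (rfl | hr')
    · rw [monadicStartRule, nonterminals_monadicStartTree]
      simp
    · obtain ⟨q, r, hr, rfl⟩ := Set.mem_iUnion.1 hr'
      refine (nonterminals_segmentTrees_perm q r.rhs).nodup_iff.2 (expand_nodup ?_)
      rw [map_fst_map_mk]
      exact G.rhs_unique r hr
  links_big := by
    rintro r' (rfl | hr')
    · rintro _ rfl
      exact .inr ⟨_, G.S_big, rfl⟩
    · obtain ⟨q, r, hr, rfl⟩ := Set.mem_iUnion.1 hr'
      rintro _ ⟨B, hB, rfl⟩
      refine .inr ⟨_, ?_, rfl⟩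
      rw [Set.mem_ofPred_eq, map_fst_map_mk]
      exact G.links_big r hr hB
  links_cover := by
    rintro r' (rfl | hr') n
    · rw [monadicStartRule, nonterminals_monadicStartTree]
      simp [expand_orderedStart]
    · obtain ⟨q, r, hr, rfl⟩ := Set.mem_iUnion.1 hr'
      refine (nonterminals_segmentTrees_perm q r.rhs).mem_iff.trans ?_
      simp only [segmentRule, Set.exists_mem_image, mem_expand_map, G.links_cover r hr]
      constructor
      · rintro ⟨C, ⟨B, hB, hC⟩, h⟩
        exact ⟨B, hB, C, hC, h⟩
      · rintro ⟨B, hB, C, hC, h⟩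
        exact ⟨C, ⟨B, hB, hC⟩, h⟩
  links_disjoint := by
    rintro r' (rfl | hr')
    · rintro _ rfl _ rfl h
      exact absurd rfl h
    · obtain ⟨q, r, hr, rfl⟩ := Set.mem_iUnion.1 hr'
      rintro _ ⟨B, hB, rfl⟩ _ ⟨B', hB', rfl⟩ hne n hn hn'
      obtain ⟨C, hC, j, rfl⟩ := mem_expand_map.1 hn
      obtain ⟨C', hC', j', h⟩ := mem_expand_map.1 hn'
      obtain rfl : C = C' := congrArg (fun m : Segment G.rkN => m.1.1) (Option.some.inj h)
      refine G.links_disjoint r hr B hB B' hB' ?_ hC hC'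
      rintro rfl
      exact hne rfl

theorem isMCFG_monadicGrammar : G.monadicGrammar.IsMCFG where
  e_mem := by simp [monadicAlphabet]
  rank_letter a h := by simp [monadicAlphabet]
  rank_nonterminal := by
    rintro (_ | n) h
    · exact absurd rfl h
    · rfl
  S_big_only := by
    rintro _ (rfl | ⟨L, hL, rfl⟩) h
    · rfl
    · exact absurd h (none_notMem_expand L)
  start_separated := by
    rintro r' (rfl | hr') h
    · replace h : none ∈ nonterminals [G.monadicStartTree] := h
      simp [nonterminals_monadicStartTree] at h
    · obtain ⟨q, r, hr, rfl⟩ := Set.mem_iUnion.1 hr'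
      exact none_notMem_expand _ ((nonterminals_segmentTrees_perm q r.rhs).mem_iff.1 h)

theorem segmentRule_lhs_eq' (r : Rule T G.rkN) (q : ∀ C, VarOrder (G.rkN C))
    (g : Option (Segment G.rkN) → List A) :
    (G.segmentRule r q).lhs =
      expand (List.zipWith (orderedBy G.rkN) r.lhs (r.rhs.map (flatEval (joinSegments q g)))) := by
  rw [segmentRule_lhs_eq, List.zipWith_map_right, List.zipWith_map_right]
  simp only [orderedBy, svars_segmentString q g]

theorem segmentRule_mem {r : Rule T G.rkN} (hr : r ∈ G.rules) (q : ∀ C, VarOrder (G.rkN C)) :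
    G.segmentRule r q ∈ G.monadicGrammar.rules :=
  .inr (Set.mem_iUnion.2 ⟨q, r, hr, rfl⟩)

/-! ### Correctness of the monadic grammar -/

/-- The derivations of the monadic grammar. -/
abbrev MonadicDerives (G : MCFTG T) :
    List (Option (Segment G.rkN)) → List (List A) → Prop :=
  G.monadicGrammar.Derives (labelEval fun s => s.1.toList)

/-- At each rule the right guess `q` consists of the actual orders of variables in the values of the
nonterminals. -/
theorem Derives.segments {B : List G.N} {d : List (VString A)} (h : G.Derives flatEval B d) :
    G.MonadicDerives (expand (List.zipWith (orderedBy G.rkN) B d)) (d.flatMap segs) := by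
  induction h with
  | rule r hr g hg ih =>
    let q (C : G.N) : VarOrder (G.rkN C) := .ofList _ (svars (g C))
    -- The order stored in `n` can be ignored, since the rule for `q` only uses the orders `q C`.
    -- The default `[]` is not reached when `g C` has `G.rkN C` variables.
    let g' (n : Option (Segment G.rkN)) : List A :=
      n.elim [] fun n => (segs (g n.1.1)).getD n.2 []
    have hseg (C : G.N) (hC : (svars (g C)).Perm (List.range (G.rkN C))) :
        (block ⟨C, q C⟩).map (fun n => g' (some n)) = segs (g C) := by
      have hlen : (segs (g C)).length = G.rkN C + 1 := by
        rw [length_segs, hC.length_eq, List.length_range]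
      refine List.ext_getElem (by simp [length_block, hlen]) fun i hi hi' => ?_
      simp [block, g', hi']
    have hjoin (C : G.N) (hC : (svars (g C)).Perm (List.range (G.rkN C))) :
        joinSegments q g' C = g C := by
      rw [joinSegments, hseg C hC, VarOrder.ofList_val hC, interleave_segs]
    have hrhs : r.rhs.map (flatEval (joinSegments q g')) = r.rhs.map (flatEval g) :=
      List.map_congr_left fun t ht => flatEval_congr fun C hC => hjoin C <|
        forall_nonterminals hr
          (P := fun C d => (svars d).Perm (List.range (G.rkN C)))
          (fun B hB => (hg B hB).forall₂ preserves_svars) t ht C hC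
    have h := Derives.rule (ev := labelEval fun s => s.1.toList) _ (segmentRule_mem hr q) g' (by
      rintro _ ⟨B, hB, rfl⟩
      have h1 := ih B hB
      rw [zipWith_orderedBy_map] at h1
      have h2 := (hg B hB).forall₂ preserves_svars
      rw [List.forall₂_map_right_iff, List.forall₂_same] at h2
      have h3 : (expand (B.map fun C => ⟨C, q C⟩)).map g' = (B.map g).flatMap segs := by
        rw [expand, List.map_map, List.flatMap_map, List.map_flatMap, List.flatMap_map]
        exact List.flatMap_congr fun C hC => hseg C (h2 C hC)
      rw [← h3] at h1
      exact h1)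
    rw [segmentRule_lhs_eq' r q g', hrhs] at h
    convert h using 1
    rw [← hrhs]
    exact (map_labelEval_segmentTrees q g' r.rhs).symm

/-- `hB` says that the guessed orders are the actual ones; equal block lengths let `hs` be cut
nonterminal by nonterminal, and `interleave_segs` restores the strings. -/
theorem eq_map_joinSegments {q : ∀ C, VarOrder (G.rkN C)} {g : Option (Segment G.rkN) → List A}
    {B : List G.N} {d : List (VString A)}
    (hd : List.Forall₂ (fun C d => (svars d).Perm (List.range (G.rkN C))) B d)
    (hB : B.map (fun C => ⟨C, q C⟩) = List.zipWith (orderedBy G.rkN) B d)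
    (hs : (expand (B.map fun C => ⟨C, q C⟩)).map g = d.flatMap segs) :
    d = B.map (joinSegments q g) := by
  induction hd with
  | nil => rfl
  | @cons C c B d hc hd ih =>
    simp only [List.map_cons, List.zipWith_cons_cons, List.cons.injEq] at hB
    obtain ⟨h1, h2⟩ := hB
    have hq : (q C).1 = svars c := by
      rw [eq_of_heq (Sigma.mk.inj h1).2, VarOrder.ofList_val hc]
    simp only [expand, List.map_cons, List.flatMap_cons, List.map_append] at hs
    obtain ⟨h3, h4⟩ := List.append_inj hs (by
      simp [length_block, length_segs, hc.length_eq])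
    rw [List.map_cons, ← ih h2 h4, joinSegments, hq]
    rw [List.map_map] at h3
    change (block ⟨C, q C⟩).map (fun n => g (some n)) = segs c at h3
    rw [h3, interleave_segs]

/-- The claim that `L` records the true orders belongs to the induction: it confirms the guesses `q`
on the links, so that their segments can be joined again. -/
theorem MonadicDerives.exists_derives {X : List (Option (Segment G.rkN))} {d' : List (List A)}
    (h : G.MonadicDerives X d') :
    ∀ L : List (Ordered G.rkN), X = expand L → L.map Sigma.fst ∈ G.big →
      ∃ d, G.Derives flatEval (L.map Sigma.fst) d ∧
        L = List.zipWith (orderedBy G.rkN) (L.map Sigma.fst) d ∧ d' = d.flatMap segs := by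
  refine Derives.rec (G := G.monadicGrammar)
    (motive := fun X d' _ => ∀ L : List (Ordered G.rkN), X = expand L → L.map Sigma.fst ∈ G.big →
      ∃ d, G.Derives flatEval (L.map Sigma.fst) d ∧
        L = List.zipWith (orderedBy G.rkN) (L.map Sigma.fst) d ∧ d' = d.flatMap segs)
    (fun r' hr' g' _ ih => ?_) h
  intro L hX hL
  obtain rfl | hr' := hr'
  · exact absurd (hX ▸ List.mem_singleton.2 rfl : none ∈ expand L) (none_notMem_expand L)
  obtain ⟨q, r, hr, rfl⟩ := Set.mem_iUnion.1 hr'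
  have hd : G.Derives flatEval r.lhs (r.rhs.map (flatEval (joinSegments q g'))) := by
    refine .rule r hr _ fun B hB => ?_
    have hbig := G.links_big r hr hB
    obtain ⟨d, hd, h1, h2⟩ := ih _ ⟨B, hB, rfl⟩ (B.map fun C => ⟨C, q C⟩) rfl
      (by rwa [map_fst_map_mk])
    rw [map_fst_map_mk] at hd h1
    rwa [← eq_map_joinSegments (hd.forall₂ preserves_svars) h1 h2]
  have hfst := map_fst_zipWith_orderedBy (rkN := G.rkN) hd.length_eq.symm
  rw [segmentRule_lhs_eq' r q g'] at hX
  -- The left-hand side of the rule already carries the orders of the computed strings, and its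
  -- expansion determines `L`.
  have hLeq := eq_of_expand (G := G) (by rw [hfst]; exact G.lhs_big r hr) hL fun n => by rw [hX]
  rw [hLeq] at hfst
  rw [hfst]
  exact ⟨_, hd, hLeq.symm, map_labelEval_segmentTrees q g' r.rhs⟩

theorem monadicDerives_none_iff {w : List A} :
    G.MonadicDerives [none] [w] ↔ ∃ d, G.Derives flatEval [G.S] [d] ∧ ssyms d = w := by
  have hsegs {d : VString A} (h : G.Derives flatEval [G.S] [d]) :
      svars d = [] ∧ segs d = [ssyms d] := by
    have h1 := h.forall₂ preserves_svars
    simp only [List.forall₂_cons, List.Forall₂.nil, and_true, G.S_rank] at h1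
    have h1 : svars d = [] := List.perm_nil.1 h1
    refine ⟨h1, ?_⟩
    obtain ⟨s, hs⟩ := List.length_eq_one_iff.1 ((length_segs d).trans (by rw [h1]; rfl))
    simp [← flatten_segs, hs]
  have heval (g : Option (Segment G.rkN) → List A) :
      labelEval (fun s => s.1.toList) g G.monadicStartTree = g (some ⟨G.orderedStart, 0⟩) := by
    simp [labelEval, labels_monadicStartTree]
  constructor
  · intro h
    -- Only the start rule has `none` on its left; it passes on the single segment of the old
    -- initial nonterminal, since `e` contributes nothing.
    have key : ∀ X d', G.MonadicDerives X d' → X = [none] →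
        ∃ w', d' = [w'] ∧ G.MonadicDerives (expand [G.orderedStart]) [w'] := by
      rintro _ _ ⟨r', hr', g, hg⟩ hX
      obtain rfl | hr' := hr'
      · have hm : (expand [G.orderedStart]).map g = [g (some ⟨G.orderedStart, 0⟩)] :=
          congrArg (List.map g) G.expand_orderedStart
        exact ⟨_, congrArg (fun x => [x]) (heval g), hm ▸ hg _ rfl⟩
      · obtain ⟨q, r, hr, rfl⟩ := Set.mem_iUnion.1 hr'
        exact absurd (hX ▸ List.mem_singleton.2 rfl : none ∈ (G.segmentRule r q).lhs)
          (none_notMem_expand _)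
    obtain ⟨w', hw, h⟩ := key _ _ h rfl
    cases hw
    obtain ⟨d, hd, -, hw⟩ := h.exists_derives [G.orderedStart] rfl G.S_big
    obtain ⟨d, rfl⟩ := List.length_eq_one_iff.1 hd.length_eq
    refine ⟨d, hd, ?_⟩
    simpa [(hsegs hd).2] using hw.symm
  · rintro ⟨d, hd, rfl⟩
    have h := hd.segments
    simp only [List.zipWith_cons_cons, List.zipWith_nil_left, orderedBy, (hsegs hd).1,
      List.flatMap_singleton, (hsegs hd).2] at h
    have hm : (expand [G.orderedStart]).map (fun _ => ssyms d) = [ssyms d] := by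
      rw [expand_orderedStart, List.map_singleton]
    have h' : G.MonadicDerives [none] [labelEval _ (fun _ => ssyms d) G.monadicStartTree] :=
      .rule (G := G.monadicGrammar) G.monadicStartRule (.inl rfl) (fun _ => ssyms d) (by
        rintro _ rfl
        exact hm.symm ▸ h)
    rwa [heval] at h'

end MCFTG

theorem yieldClass_MCFT_subset_MCF (A : Type u) : yieldClass (MCFT A) ⊆ MCF A := by
  rintro _ ⟨T, _, ⟨G, rfl⟩, rfl⟩
  refine ⟨_, G.monadicGrammar, MCFTG.isMCFG_monadicGrammar, Set.ext fun w => ?_⟩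
  rw [MCFTG.mem_treeYield_image_iff]
  exact MCFTG.isMCFG_monadicGrammar.mem_stringLanguage_iff.trans MCFTG.monadicDerives_none_iff

end Strings

end MultipleCF

theorem mainTheorem9 (A : Type*) [Infinite A] :
    MultipleCF.yieldClass (MultipleCF.MCFT A) = MultipleCF.MCF A ∧
      MultipleCF.MCF A = MultipleCF.yieldClass (MultipleCF.MRT A) := by
  have h₁ := MultipleCF.yieldClass_MCFT_subset_MCF A
  have h₂ := MultipleCF.MCF_subset_yieldClass_MRT A
  have h₃ := MultipleCF.yieldClass_MRT_subset_yieldClass_MCFT A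
  exact ⟨h₁.antisymm (h₂.trans h₃), h₂.antisymm (h₃.trans h₁)⟩
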